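/- **Graphs and labelings.** Fix a constant $c\ge 2$. For $s\ge 2$ the *base graph* $G_s$ is the following directed acyclic graph with in-degree at most two. * Take a pyramid with levels $0,\dots,s-1$; level $i$ has vertices $(i,j)$, $0\le j<s-i$, and for $i\ge1$ the vertex $(i,j)$ has incoming edges from $(i-1,j)$ and $(i-1,j+1)$. Add on each level a directed path through all its vertices, by increasing $j$ if $i$ is even and by decreasing $j$ if $i$ is odd. Replace each vertex of in-degree three by a pyramid of height three (three sources, one for each of the incoming edges, two middle vertices, one apex), whose apex takes over the outgoing edges. * For $2\le i\le s$ choose any vertex $r_i$ of level $i-1$ (the root of a subpyramid of height $i$). * Add a path $v_1\to\dots\to v_{cs}$, an edge $r_s\to v_1$, and edges $r_i\to v_q$ for all $2\le i\le s$ and all $q\equiv i-1 \pmod{s-1}$. * Add a path $w_1\to\dots\to w_{s-1}$, an edge $v_{cs}\to w_1$, and edges $r_i\to w_{i-1}$ for $2\le i\le s$. The *layered graph* $G'_s$ arises from $G_s$ by making $s$ copies (the original being one of them) of the vertices in $C=\{r_2,\dots,r_s,v_{cs},w_1,\dots,w_{s-1}\}$: an edge between vertices of $C$ is repeated within each copy,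 and an edge from outside $C$ into $C$ is repeated for each copy of its head. (The original copies of the $r_i$ and of $v_{cs}$ keep their edges to vertices outside $C$.) Its sinks, the *targets*, are the $s$ copies of $w_{s-1}$. For an oracle $\mathcal O$ with values in $\{0,1\}^\kappa$ and $\zeta\in\{0,1\}^\kappa$, the label of a source $v$ is $\mathcal O(v,\zeta)$, and the label of any other vertex $v$ is $\mathcal O(v,\text{labels of the direct predecessors of }v)$. **Hash functions.** Let $s=s(\kappa)\ge2$ be polynomially bounded, let $\zeta_\kappa\in\{0,1\}^\kappa$ and choices of the roots $r_i$ be given for each $\kappa$, and let $n=n(\kappa)$ be the number of vertices of $G'_{s(\kappa)}$. The oracle $\mathcal O$ is uniformly random; it answers label queries as above and, on a disjoint domain, queries $x\in\{0,1\}^\kappa$, always with $\kappa$ bits. $\mathcal H_1$ outputs the static string $(R_0,\dots,R_{s-1})$ of the labels of the $s$ targets. On input $x\in\{0,1\}^\kappa$, $\mathcal H_2$ computes $\rho_0=\mathcal O(x)$ and $\rho_1=\mathcal O(x+1 \bmod 2^\kappa)$, looks up the single word $R_\iota$ with $\iota=\rho_0\bmod s$, and outputs $h_\kappa(x)=R_\iota\oplus\rho_1$.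 **Hardness.** An adversary $\mathcal B$ runs in iterations. In each iteration it computes from the current state (a bit string) and its coins a batch of oracle queries, and from the answers the next state, items that it appends to a write-only output register, and whether it stops. The initial state is its input. $\mathcal B$ may be non-uniform and computationally unbounded and may use any finite number of coins, but it makes polynomially many (in $\kappa$) iterations with polynomially many queries in each. Let $\mathrm{s\text{-}mem}(M,\mathcal B)$ be the number of states of size at least $M$ in an execution. The family is *$(\Lambda,\tau,q)$-hard* if for every $\Delta\in\omega(\log\kappa)$, every string $R$ of size $\Lambda-\Delta$, possibly depending on $\mathcal O$, every such $\mathcal B$ with input $R$, and every sequence of sets $X_\kappa\subseteq\{0,1\}^\kappa$, there is a negligible function $\varepsilon$ such that for all large $\kappa$ with $\Delta\le\Lambda$ and $|X_\kappa|=q$ $$\Pr\bigl[\mathcal B\text{ outputs exactly }\{(x,h_\kappa(x)):x\in X_\kappa\}\ \text{ and }\ \mathrm{s\text{-}mem}(\Lambda,\mathcal B)<\tau\bigr]<\varepsilon(\kappa),$$ where the probability is over $\mathcal O$ and the coins of $\mathcal B$. The sizes $\Lambda$, $\Delta$ are counted either in bits or in words of $\kappa$ bits, as stated. **Theorem.**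 There is a function $\tau\in\Theta(n)$ such that the following hold. 1. With memory counted in bits: for every constant $\lambda\in\mathbb N$, every $\Lambda\in\Theta(\sqrt n)$ and every $q\in\omega(\Lambda\log\Lambda)$, the family $(\mathcal H_1,\mathcal H_2)$ is $(\Lambda-\lambda,\tau,q)$-hard. 2. With memory counted in words of $\kappa$ bits: there is a $\delta>0$ such that for every constant $\lambda\in\mathbb N$, every $\Lambda\in\Theta(\sqrt n)$ with $\Lambda\le\delta\sqrt n$ for all large $\kappa$, and every $q\in\omega(\Lambda\log\Lambda)$, the family $(\mathcal H_1,\mathcal H_2)$ is $(\Lambda-\lambda,\tau,q)$-hard. -/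

import Mathlib

open Filter Asymptotics

/-! ### Directed acyclic graphs of in-degree at most two, and their labelings -/

/-- A finite directed acyclic graph of in-degree at most two: `pred v` lists the direct
predecessors of `v`. -/
structure Dag where
  V : Type
  finite : Finite V
  pred : V → List V
  length_pred : ∀ v, (pred v).length ≤ 2
  wf : WellFounded fun u v => u ∈ pred v

/-- A vertex without outgoing edges. -/
def Dag.IsSink (G : Dag) (v : G.V) : Prop := ∀ u, v ∉ G.pred u

/-- Tuples of one or two labels, where a label is a string of `κ` bits. -/
abbrev LabelTuple (κ : ℕ) : Type :=
  {l : List (BitVec κ) // 1 ≤ l.length ∧ l.length ≤ 2}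

/-- The labels of the predecessors of a vertex, or the input label `ζ` for a source. -/
def LabelTuple.ofList {κ : ℕ} (ζ : BitVec κ) (l : List (BitVec κ)) (h : l.length ≤ 2) :
    LabelTuple κ :=
  if hl : l = [] then ⟨[ζ], by simp⟩
  else ⟨l, List.length_pos_iff.mpr hl, h⟩

/-- The `(O, ζ)`-labeling of a graph:
`label v = O (v, ζ)` for a source, and `label v = O (v, labels of pred v)` otherwise. -/
noncomputable def Dag.label (G : Dag) {κ : ℕ} (O : G.V × LabelTuple κ → BitVec κ)
    (ζ : BitVec κ) : G.V → BitVec κ :=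
  G.wf.fix fun v ih =>
    O (v, LabelTuple.ofList ζ ((G.pred v).attach.map fun u => ih u.1 u.2)
      (by simpa using G.length_pred v))

theorem Dag.label_eq (G : Dag) {κ : ℕ} (O : G.V × LabelTuple κ → BitVec κ) (ζ : BitVec κ)
    (v : G.V) :
    G.label O ζ v =
      O (v, LabelTuple.ofList ζ ((G.pred v).map (G.label O ζ))
        (by simpa using G.length_pred v)) := by
  have h : (G.pred v).attach.map (fun u => G.label O ζ u.1) = (G.pred v).map (G.label O ζ) := by
    simp
  conv_lhs => rw [Dag.label, WellFounded.fix_eq]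
  congr 2
  simp only [← h]
  rfl

/-! ### The layering transformation -/

/-- `k` copies of the vertices in `C`, numbered `0, …, k - 1`, copy `0` being the original.
An edge inside `C` is repeated in each copy, and an edge that enters `C` is repeated for each
copy of its head. -/
noncomputable def Dag.layer (G : Dag) (C : Set G.V) (k : ℕ) : Dag where
  V := {x : G.V × ℕ // x.2 < k ∧ (x.2 = 0 ∨ x.1 ∈ C)}
  finite := by
    have := G.finite
    refine Finite.of_injective
      (fun x : {x : G.V × ℕ // x.2 < k ∧ (x.2 = 0 ∨ x.1 ∈ C)} =>
        ((x.1.1, ⟨x.1.2, x.2.1⟩) : G.V × Fin k)) ?_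
    rintro ⟨⟨a, i⟩, ha⟩ ⟨⟨b, j⟩, hb⟩ h
    simpa using h
  pred := fun x =>
    (G.pred x.1.1).map fun u =>
      open Classical in
      if hu : u ∈ C then ⟨(u, x.1.2), x.2.1, Or.inr hu⟩
      else ⟨(u, 0), Nat.zero_lt_of_lt x.2.1, Or.inl rfl⟩
  length_pred := fun x => by simpa using G.length_pred x.1.1
  wf := by
    refine Subrelation.wf (r := InvImage (fun u v => u ∈ G.pred v) fun x => x.1.1) ?_
      (InvImage.wf _ G.wf)
    intro x y hxy
    simp only [List.mem_map] at hxy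
    obtain ⟨u, hu, rfl⟩ := hxy
    by_cases h : u ∈ C <;> simpa [InvImage, h] using hu

theorem Dag.mem_pred_layer (G : Dag) (C : Set G.V) (k : ℕ) (x y : (G.layer C k).V) :
    x ∈ (G.layer C k).pred y ↔
      x.1.1 ∈ G.pred y.1.1 ∧ (x.1.1 ∈ C ∧ x.1.2 = y.1.2 ∨ x.1.1 ∉ C ∧ x.1.2 = 0) := by
  refine Iff.trans (List.mem_map (l := G.pred y.1.1)) ?_
  constructor
  · rintro ⟨a, ha, rfl⟩
    by_cases hC : a ∈ C
    · rw [dif_pos hC]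
      exact ⟨ha, Or.inl ⟨hC, rfl⟩⟩
    · rw [dif_neg hC]
      exact ⟨ha, Or.inr ⟨hC, rfl⟩⟩
  · rintro ⟨ha, ⟨hC, h⟩ | ⟨hC, h⟩⟩
    · refine ⟨x.1.1, ha, ?_⟩
      rw [dif_pos hC]
      exact Subtype.ext (Prod.ext rfl h.symm)
    · refine ⟨x.1.1, ha, ?_⟩
      rw [dif_neg hC]
      exact Subtype.ext (Prod.ext rfl h.symm)

/-! ### The base graph with parameter `s` -/

/-- The level paths of the pyramid run in alternating directions, so that the last vertex of a
level is a predecessor of the first vertex of the next one: `(i, j)` is preceded on the path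
through level `i` by `(i, j - 1)` if `i` is even and by `(i, j + 1)` if `i` is odd.  This is the
position of the predecessor in level `i`. -/
def prevPos (i j : ℕ) : ℕ := if Even i then j - 1 else j + 1

/-- `(i, j)` is a pyramid vertex of in-degree three: it lies above the bottom level `0` and is
not the first vertex of the path through its level. -/
def IsTriple (s i j : ℕ) : Prop :=
  1 ≤ i ∧ i + j < s ∧ if Even i then 0 < j else i + j + 1 < s

instance (s i j : ℕ) : Decidable (IsTriple s i j) := by
  unfold IsTriple
  infer_instance

/-- Vertices of the base graph.
* `pyr i j`: the `j`-th vertex on level `i` of a pyramid with `s` levels, level `0` (with `s`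
  vertices) being the bottom and level `s - 1` the apex; it is the root of a subpyramid of
  height `i + 1`.
* `bot`, `mid`: the three sources (one for each of the three incoming edges) and the two middle
  vertices of the height-three pyramid that replaces a vertex of in-degree three; the apex of
  that small pyramid is `pyr i j`.
* `chain q`: the vertex `v_{q+1}` of the path `v_1, …, v_{c s}`.
* `top l`: the vertex `w_{l+1}` of the path `w_1, …, w_{s-1}`. -/
inductive BaseVertex (s c : ℕ) : Type
  | pyr (i j : ℕ) (h : i + j < s)
  | bot (t : Fin 3) (i j : ℕ) (h : IsTriple s i j)
  | mid (t : Fin 2) (i j : ℕ) (h : IsTriple s i j)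
  | chain (q : ℕ) (h : q < c * s)
  | top (l : ℕ) (h : l + 1 < s)
  deriving DecidableEq

namespace BaseVertex

variable {s c : ℕ}

/-- The chosen root `r_{i+1}` of a subpyramid of height `i + 1`. -/
def rootAt (root : ∀ i : Fin s, Fin (s - i)) (i : ℕ) (h : i < s) : BaseVertex s c :=
  pyr i (root ⟨i, h⟩) (by have := (root ⟨i, h⟩).isLt; simp only at this; omega)

/-- Direct predecessors in the base graph.  In terms of `v_1, …, v_{c s}` and `w_1, …, w_{s-1}`:
the edges are `v_q → v_{q+1}`, `r_s → v_1`, `r_i → v_q` for `q ≡ i - 1` modulo `s - 1`,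
`v_{c s} → w_1`, `w_l → w_{l+1}` and `r_i → w_{i-1}`, for `2 ≤ i ≤ s`. -/
def pred (hs : 2 ≤ s) (hc : 2 ≤ c) (root : ∀ i : Fin s, Fin (s - i)) :
    BaseVertex s c → List (BaseVertex s c)
  | pyr i j h =>
      if hi : i = 0 then
        if 0 < j then [pyr 0 (prevPos 0 j) (by simp only [prevPos, Even.zero, if_true]; omega)]
        else []
      else if h3 : IsTriple s i j then [mid 0 i j h3, mid 1 i j h3]
      else [pyr (i - 1) j (by omega), pyr (i - 1) (j + 1) (by omega)]
  | mid t i j h => [bot t.castSucc i j h, bot t.succ i j h]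
  | bot 0 i j h => [pyr (i - 1) j (by have := h.2.1; omega)]
  | bot 1 i j h => [pyr (i - 1) (j + 1) (by have := h.1; have := h.2.1; omega)]
  | bot 2 i j h =>
      [pyr i (prevPos i j) (by
        have h1 := h.2.1
        have h2 := h.2.2
        unfold prevPos
        split_ifs at h2 ⊢ <;> omega)]
  | chain q h =>
      if q = 0 then [rootAt root (s - 1) (by omega), rootAt root 1 (by omega)].dedup
      else [chain (q - 1) (by omega), rootAt root (q % (s - 1) + 1)
        (by have := Nat.mod_lt q (show 0 < s - 1 by omega); omega)]
  | top l h =>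
      if l = 0 then
        [chain (c * s - 1) (by have := Nat.mul_pos (show 0 < c by omega) (show 0 < s by omega)
                               omega), rootAt root 1 (by omega)]
      else [top (l - 1) (by omega), rootAt root (l + 1) h]

/-- A topological rank. -/
def rank : BaseVertex s c → ℕ
  | pyr i j _ => 3 * (i * s + if Even i then j else s - 1 - i - j) + 2
  | bot _ i j _ => 3 * (i * s + if Even i then j else s - 1 - i - j)
  | mid _ i j _ => 3 * (i * s + if Even i then j else s - 1 - i - j) + 1
  | chain q _ => 3 * (s * s) + q
  | top l _ => 3 * (s * s) + c * s + l

theorem rank_lt (hs : 2 ≤ s) (hc : 2 ≤ c) (root : ∀ i : Fin s, Fin (s - i))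
    (u v : BaseVertex s c) (huv : u ∈ pred hs hc root v) : rank u < rank v := by
  have hrank : ∀ (i j : ℕ) (h : i + j < s), rank (pyr i j h : BaseVertex s c) < 3 * (s * s) := by
    intro i j h
    have h1 : (i + 1) * s ≤ s * s := Nat.mul_le_mul_right s (by omega)
    have h2 : (i + 1) * s = i * s + s := by ring
    simp only [rank]
    split_ifs <;> omega
  have hroot : ∀ (i : ℕ) (h : i < s),
      rank (rootAt root i h : BaseVertex s c) < 3 * (s * s) := fun i h => hrank _ _ _
  have hlow : ∀ (i j j' : ℕ) (h : i - 1 + j' < s), 1 ≤ i → i + j < s →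
      rank (pyr (i - 1) j' h : BaseVertex s c) <
        3 * (i * s + if Even i then j else s - 1 - i - j) := by
    intro i j j' h hi hj
    obtain ⟨i, rfl⟩ : ∃ i', i = i' + 1 := ⟨i - 1, by omega⟩
    have h2 : (i + 1) * s = i * s + s := by ring
    simp only [rank, Nat.add_sub_cancel] at h ⊢
    split_ifs <;> omega
  cases v with
  | pyr i j h =>
    simp only [pred] at huv
    split_ifs at huv with hi hj h3
    · simp only [List.mem_singleton] at huv
      subst huv hi
      simp [rank, prevPos]
      omega
    · simp at huv
    · simp only [List.mem_cons, List.not_mem_nil, or_false] at huv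
      rcases huv with rfl | rfl <;> simp only [rank] <;> omega
    · simp only [List.mem_cons, List.not_mem_nil, or_false] at huv
      rcases huv with rfl | rfl
      · exact (hlow i j _ _ (by omega) h).trans_le (by simp only [rank]; omega)
      · exact (hlow i j _ _ (by omega) h).trans_le (by simp only [rank]; omega)
  | mid t i j h =>
    simp only [pred, List.mem_cons, List.not_mem_nil, or_false] at huv
    rcases huv with rfl | rfl <;> simp only [rank] <;> omega
  | bot t i j h =>
    have h1 := h.1
    have h2 := h.2.1
    have h3 := h.2.2
    fin_cases t
    · simp only [pred, List.mem_singleton] at huv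
      subst huv
      exact hlow i j _ _ h1 h2
    · simp only [pred, List.mem_singleton] at huv
      subst huv
      exact hlow i j _ _ h1 h2
    · simp only [pred, List.mem_singleton] at huv
      subst huv
      simp only [rank, prevPos]
      split_ifs at h3 ⊢ <;> omega
  | chain q h =>
    simp only [pred] at huv
    split_ifs at huv with hq
    · simp only [List.mem_dedup, List.mem_cons, List.not_mem_nil, or_false] at huv
      rcases huv with rfl | rfl <;> exact (hroot _ _).trans_le (by simp only [rank]; omega)
    · simp only [List.mem_cons, List.not_mem_nil, or_false] at huv
      rcases huv with rfl | rfl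
      · simp only [rank]
        omega
      · exact (hroot _ _).trans_le (by simp only [rank]; omega)
  | top l h =>
    have hcs : 0 < c * s := Nat.mul_pos (by omega) (by omega)
    simp only [pred] at huv
    split_ifs at huv with hl <;> simp only [List.mem_cons, List.not_mem_nil, or_false] at huv <;>
      rcases huv with rfl | rfl
    · simp only [rank]
      omega
    · exact (hroot _ _).trans_le (by simp only [rank]; omega)
    · simp only [rank]
      omega
    · exact (hroot _ _).trans_le (by simp only [rank]; omega)

instance : Finite (BaseVertex s c) := by
  let f : BaseVertex s c → Fin 5 × Fin 3 × Fin (s + c * s) × Fin (s + c * s) := fun v =>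
    match v with
    | pyr i j h => (0, 0, ⟨i, by omega⟩, ⟨j, by omega⟩)
    | bot t i j h => (1, t, ⟨i, by have := h.2.1; omega⟩, ⟨j, by have := h.2.1; omega⟩)
    | mid t i j h =>
        (2, t.castSucc, ⟨i, by have := h.2.1; omega⟩, ⟨j, by have := h.2.1; omega⟩)
    | chain q h => (3, 0, ⟨q, by omega⟩, ⟨q, by omega⟩)
    | top l h => (4, 0, ⟨l, by omega⟩, ⟨l, by omega⟩)
  refine Finite.of_injective f ?_
  intro u v huv
  cases u <;> cases v <;> simp_all [f]

/-- The vertices that are copied by the layering: the chosen roots `r_2, …, r_s`, the last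
vertex `v_{c s}` of the chain, and `w_1, …, w_{s-1}`. -/
def copied (root : ∀ i : Fin s, Fin (s - i)) : Set (BaseVertex s c) :=
  {u | (∃ (i : ℕ) (h : i < s), 1 ≤ i ∧ u = rootAt root i h) ∨
    (∃ (q : ℕ) (h : q < c * s), q + 1 = c * s ∧ u = chain q h) ∨
    ∃ (l : ℕ) (h : l + 1 < s), u = top l h}

theorem exists_succ (hs : 2 ≤ s) (hc : 2 ≤ c) (root : ∀ i : Fin s, Fin (s - i))
    (u : BaseVertex s c) (hu : u ≠ top (s - 2) (by omega)) :
    ∃ v, u ∈ pred hs hc root v ∧ (u ∈ copied root → v ∈ copied root) := by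
  have hcs : 2 * s ≤ c * s := Nat.mul_le_mul_right s hc
  have htop : ∀ (l : ℕ) (h : l + 1 < s), (top l h : BaseVertex s c) ∈ copied root :=
    fun l h => Or.inr (Or.inr ⟨l, h, rfl⟩)
  have step : ∀ v : BaseVertex s c, u ∈ pred hs hc root v →
      (u ∈ copied root → v ∈ copied root) →
      ∃ v, u ∈ pred hs hc root v ∧ (u ∈ copied root → v ∈ copied root) :=
    fun v h h' => ⟨v, h, h'⟩
  cases u with
  | pyr i j h =>
    by_cases hC : (pyr i j h : BaseVertex s c) ∈ copied root
    · rcases hC with ⟨i', h', h1, he⟩ | ⟨_, _, _, he⟩ | ⟨_, _, he⟩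
      · refine step (.top (i' - 1) (by omega)) ?_ fun _ => htop _ _
        rw [he]
        simp only [pred]
        split_ifs with h0
        · have : i' = 1 := by omega
          subst this
          simp
        · have : i' - 1 + 1 = i' := by omega
          simp [this]
      · cases he
      · cases he
    · have hi : i + 1 < s := by
        by_contra hi
        have hi' : i = s - 1 := by omega
        subst hi'
        refine hC (Or.inl ⟨s - 1, by omega, by omega, ?_⟩)
        have := (root ⟨s - 1, by omega⟩).isLt
        simp only at this
        simp only [rootAt, pyr.injEq, true_and]
        omega
      by_cases hj : i + 1 + j < s
      · by_cases h3 : IsTriple s (i + 1) j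
        · exact step (.bot 0 (i + 1) j h3) (by simp [pred]) fun h' => (hC h').elim
        · exact step (.pyr (i + 1) j hj) (by simp [pred, h3])
            fun h' => (hC h').elim
      · obtain ⟨j, rfl⟩ : ∃ j', j = j' + 1 := ⟨j - 1, by omega⟩
        by_cases h3 : IsTriple s (i + 1) j
        · exact step (.bot 1 (i + 1) j h3) (by simp [pred]) fun h' => (hC h').elim
        · exact step (.pyr (i + 1) j (by omega)) (by simp [pred, h3])
            fun h' => (hC h').elim
  | bot t i j h =>
    have hC : (bot t i j h : BaseVertex s c) ∉ copied root := by
      simp [copied, rootAt]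
    fin_cases t
    · exact step (.mid 0 i j h) (by simp [pred]) fun h' => (hC h').elim
    · exact step (.mid 0 i j h) (by simp [pred]) fun h' => (hC h').elim
    · exact step (.mid 1 i j h) (by simp [pred]) fun h' => (hC h').elim
  | mid t i j h =>
    have hC : (mid t i j h : BaseVertex s c) ∉ copied root := by
      simp [copied, rootAt]
    refine step (.pyr i j h.2.1) ?_ fun h' => (hC h').elim
    have h1 := h.1
    fin_cases t <;> simp [pred, h, show i ≠ 0 by omega]
  | chain q h =>
    by_cases hq : q + 1 = c * s
    · refine step (.top 0 (by omega)) ?_ fun _ => htop _ _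
      simp only [pred, if_true, List.mem_cons, chain.injEq]
      omega
    · have hC : (chain q h : BaseVertex s c) ∉ copied root := by
        simp [copied, rootAt]
        omega
      exact step (.chain (q + 1) (by omega)) (by simp [pred])
        fun h' => (hC h').elim
  | top l h =>
    have hl : l + 2 < s := by
      by_contra hl
      refine hu ?_
      simp only [top.injEq]
      omega
    exact step (.top (l + 1) (by omega)) (by simp [pred]) fun _ => htop _ _

theorem top_notMem_pred (hs : 2 ≤ s) (hc : 2 ≤ c) (root : ∀ i : Fin s, Fin (s - i))
    (v : BaseVertex s c) : top (s - 2) (by omega) ∉ pred hs hc root v := by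
  intro h
  cases v with
  | pyr i j h' => simp only [pred] at h; split_ifs at h <;> simp at h
  | mid t i j h' => simp [pred] at h
  | bot t i j h' => fin_cases t <;> simp [pred] at h
  | chain q h' =>
    simp only [pred] at h
    split_ifs at h <;> simp [rootAt] at h
  | top l h' =>
    simp only [pred] at h
    split_ifs at h <;> simp [rootAt] at h
    omega

end BaseVertex

/-- The base graph with parameter `s`, chain length `c * s` and chosen roots `root`. -/
def baseGraph (s c : ℕ) (hs : 2 ≤ s) (hc : 2 ≤ c) (root : ∀ i : Fin s, Fin (s - i)) : Dag where
  V := BaseVertex s c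
  finite := inferInstance
  pred := BaseVertex.pred hs hc root
  length_pred := by
    intro v
    cases v with
    | pyr i j h => simp only [BaseVertex.pred]; split_ifs <;> simp
    | mid t i j h => simp [BaseVertex.pred]
    | bot t i j h => fin_cases t <;> simp [BaseVertex.pred]
    | chain q h =>
      simp only [BaseVertex.pred]
      split_ifs
      · exact (List.dedup_sublist _).length_le
      · simp
    | top l h => simp only [BaseVertex.pred]; split_ifs <;> simp
  wf := Subrelation.wf (r := InvImage (· < ·) BaseVertex.rank)
    (fun {u v} h => BaseVertex.rank_lt hs hc root u v h) (InvImage.wf _ Nat.lt_wfRel.wf)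

/-- The layered graph: `s` copies of the roots, of `v_{c s}` and of the path `w_1, …, w_{s-1}`
on top of the rest of the base graph. -/
noncomputable def layeredGraph (s c : ℕ) (hs : 2 ≤ s) (hc : 2 ≤ c)
    (root : ∀ i : Fin s, Fin (s - i)) : Dag :=
  (baseGraph s c hs hc root).layer (BaseVertex.copied root) s

/-- The target in copy `k`: the copy of `w_{s-1}`. -/
def layeredTarget (s c : ℕ) (hs : 2 ≤ s) (hc : 2 ≤ c) (root : ∀ i : Fin s, Fin (s - i))
    (k : Fin s) : (layeredGraph s c hs hc root).V :=
  ⟨(BaseVertex.top (s - 2) (by omega), k), k.2, Or.inr (Or.inr (Or.inr ⟨s - 2, by omega, rfl⟩))⟩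

/-- The targets of the layered graph are exactly its sinks. -/
theorem isSink_layeredGraph_iff (s c : ℕ) (hs : 2 ≤ s) (hc : 2 ≤ c)
    (root : ∀ i : Fin s, Fin (s - i)) (x : (layeredGraph s c hs hc root).V) :
    (layeredGraph s c hs hc root).IsSink x ↔ ∃ k, x = layeredTarget s c hs hc root k := by
  have hcs : 2 * s ≤ c * s := Nat.mul_le_mul_right s hc
  have key : ∀ y : (layeredGraph s c hs hc root).V,
      x ∈ (layeredGraph s c hs hc root).pred y ↔
        (x.1.1 : BaseVertex s c) ∈ BaseVertex.pred hs hc root y.1.1 ∧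
          ((x.1.1 : BaseVertex s c) ∈ BaseVertex.copied root ∧ x.1.2 = y.1.2 ∨
            (x.1.1 : BaseVertex s c) ∉ BaseVertex.copied root ∧ x.1.2 = 0) :=
    fun y => Dag.mem_pred_layer _ _ _ x y
  constructor
  · intro hx
    by_cases hu : (x.1.1 : BaseVertex s c) = .top (s - 2) (by omega)
    · exact ⟨⟨x.1.2, x.2.1⟩, Subtype.ext (Prod.ext hu rfl)⟩
    · exfalso
      obtain ⟨v, hv, hcop⟩ := BaseVertex.exists_succ hs hc root x.1.1 hu
      by_cases hC : (x.1.1 : BaseVertex s c) ∈ BaseVertex.copied root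
      · exact hx ⟨(v, x.1.2), x.2.1, Or.inr (hcop hC)⟩ ((key _).2 ⟨hv, Or.inl ⟨hC, rfl⟩⟩)
      · have h0 : x.1.2 = 0 := x.2.2.resolve_right hC
        exact hx ⟨(v, 0), Nat.zero_lt_of_lt x.2.1, Or.inl rfl⟩
          ((key _).2 ⟨hv, Or.inr ⟨hC, h0⟩⟩)
  · rintro ⟨k, rfl⟩ y hy
    exact BaseVertex.top_notMem_pred hs hc root y.1.1 ((key y).1 hy).1

/-! ### Parallel random oracle algorithms -/

/-- A (non-uniform) algorithm with parallel access to an oracle from `Q` to `A`, with coins in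
`C`, that writes items of `Y` to its output register.  In iteration `i` it computes, from the
state handed over by the previous iteration and its coins, a batch of queries; from these and
the answers it computes the next state (a bit string), the items that it appends to the output
register, and whether it terminates. -/
structure PROMAlg (Q A C Y : Type) where
  batch : ℕ → C → List Bool → List Q
  next : ℕ → C → List Bool → List A → List Bool
  append : ℕ → C → List Bool → List A → List Y
  halt : ℕ → C → List Bool → List A → Bool

/-- State, output register and termination flag. -/
structure PROMConfig (Y : Type) where
  state : List Bool
  out : List Y
  halted : Bool

namespace PROMAlg

variable {Q A C Y : Type}

/-- The configuration after `i` iterations with oracle `O`, coins `ρ` and input `x`. The initial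
state is the input. -/
def run (B : PROMAlg Q A C Y) (O : Q → A) (ρ : C) (x : List Bool) : ℕ → PROMConfig Y
  | 0 => ⟨x, [], false⟩
  | i + 1 =>
    let S := B.run O ρ x i
    if S.halted then S
    else
      let a := (B.batch i ρ S.state).map O
      ⟨B.next i ρ S.state a, S.out ++ B.append i ρ S.state a, B.halt i ρ S.state a⟩

/-- The algorithm terminates within `t` iterations, with at most `t` queries in each. -/
def RunsWithin (B : PROMAlg Q A C Y) (O : Q → A) (ρ : C) (x : List Bool) (t : ℕ) : Prop :=
  (B.run O ρ x t).halted = true ∧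
    ∀ i < t, (B.run O ρ x i).halted = false → (B.batch i ρ (B.run O ρ x i).state).length ≤ t

/-- The algorithm terminates, and the set of items in its output register is `S`. -/
def Outputs (B : PROMAlg Q A C Y) (O : Q → A) (ρ : C) (x : List Bool) (S : Set Y) : Prop :=
  ∃ i, (B.run O ρ x i).halted = true ∧ {y | y ∈ (B.run O ρ x i).out} = S

/-- The number of states `σ_i` of the execution (each handed over to a next iteration) that
have at least `M` bits. -/
noncomputable def sustainedMem (B : PROMAlg Q A C Y) (O : Q → A) (ρ : C) (x : List Bool)
    (M : ℕ) : ℕ∞ :=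
  {i | (B.run O ρ x i).halted = false ∧ M ≤ (B.run O ρ x i).state.length}.encard

end PROMAlg

/-! ### Static-memory hash function families -/

/-- A static-memory hash function family, mapping `κ` bits to `κ` bits, for oracles from a
finite set `Query κ` to `κ` bits.  `H1 κ O` is the static string `R`, as a list of words of `κ`
bits.  `H2 κ O len seek x` is the value of the hash function at `x`, where `len` is the number
of words of `R`, and `seek` gives access to the words of `R`. -/
structure SHF where
  Query : ℕ → Type
  finite : ∀ κ, Finite (Query κ)
  H1 : ∀ κ, (Query κ → BitVec κ) → List (BitVec κ)
  H2 : ∀ κ, (Query κ → BitVec κ) → ℕ → (ℕ → BitVec κ) → BitVec κ → BitVec κ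

/-- The hash function `h_κ` with oracle `O`. -/
def SHF.hash (H : SHF) (κ : ℕ) (O : H.Query κ → BitVec κ) (x : BitVec κ) : BitVec κ :=
  H.H2 κ O (H.H1 κ O).length (fun i => (H.H1 κ O).getD i 0) x

/-- Probability of the event `E` under the uniform distribution on a finite type. -/
noncomputable def uniformProb {Ω : Type} (E : Set Ω) : ℝ :=
  (Nat.card E : ℝ) / (Nat.card Ω : ℝ)

/-- `(Λ, τ, q)`-hardness of a static-memory hash function family, where the memory parameter `Λ`
is counted in blocks of `u κ` bits (`u = 1`: in bits; `u = κ`: in words of `κ` bits).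

For every `Δ ∈ ω(log κ)`, every string `R` of `Λ - Δ` blocks, even one that depends on the
oracle, every adversary `B` on input `R` with polynomially many iterations and oracle queries
and any finite number `r κ` of coins, and every set `X` of `q` inputs fixed in advance, the
following has negligible probability over the oracle and the coins: `B` outputs exactly the set
of pairs `(x, h_κ x)`, `x ∈ X`, with fewer than `τ` states of at least `Λ` blocks. -/
def SHF.IsHard (H : SHF) (u Λ τ q : ℕ → ℕ) : Prop :=
  ∀ Δ : ℕ → ℕ, (fun κ : ℕ => Real.log κ) =o[atTop] (fun κ => (Δ κ : ℝ)) →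
  ∀ R : ∀ κ, (H.Query κ → BitVec κ) → List Bool,
  (∀ κ O, (R κ O).length = u κ * (Λ κ - Δ κ)) →
  ∀ (r : ℕ → ℕ)
    (B : ∀ κ, PROMAlg (H.Query κ) (BitVec κ) (BitVec (r κ)) (BitVec κ × BitVec κ)),
  (∃ p : Polynomial ℕ, ∀ κ O ρ, (B κ).RunsWithin O ρ (R κ O) (p.eval κ)) →
  ∀ X : ∀ κ, Finset (BitVec κ),
  ∃ ε : ℕ → ℝ, SuperpolynomialDecay atTop (fun κ : ℕ => (κ : ℝ)) ε ∧
    ∀ᶠ κ in atTop, Δ κ ≤ Λ κ → (X κ).card = q κ →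
      uniformProb {ω : (H.Query κ → BitVec κ) × BitVec (r κ) |
        (B κ).Outputs ω.1 ω.2 (R κ ω.1) {y | y.1 ∈ X κ ∧ y.2 = H.hash κ ω.1 y.1} ∧
        (B κ).sustainedMem ω.1 ω.2 (R κ ω.1) (u κ * Λ κ) < (τ κ : ℕ∞)} < ε κ

/-- The static-memory hash function family of a family of graphs with enumerated targets and
input labels `ζ κ`.  The oracle answers label queries and, on a disjoint domain, queries in
`{0,1}^κ`.  `H1` is the graph function: it outputs the labels of the targets.  `H2` queries
`ρ₀ = O x` and `ρ₁ = O (x + 1)`, uses `ρ₀` to choose an index, looks up the word of `R` at this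
index, and outputs the bitwise sum of this word and `ρ₁`. -/
noncomputable def graphSHF (G : ℕ → Dag) (targets : ∀ κ, List (G κ).V) (ζ : ∀ κ, BitVec κ) :
    SHF where
  Query κ := ((G κ).V × LabelTuple κ) ⊕ BitVec κ
  finite κ := by
    have := (G κ).finite
    have : Finite (BitVec κ) := Finite.of_injective BitVec.toFin fun a b h => by
      simpa [BitVec.toFin_inj] using h
    have : Finite (LabelTuple κ) :=
      ((List.finite_length_le (BitVec κ) 2).subset fun l hl => hl.2).to_subtype
    infer_instance
  H1 κ O := (targets κ).map ((G κ).label (fun a => O (Sum.inl a)) (ζ κ))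
  H2 κ O len seek x :=
    seek ((O (Sum.inr x)).toNat % len) ^^^ O (Sum.inr (x + 1))

/-- The static-memory hash function family of the layered graphs with parameters `s κ`. -/
noncomputable def layeredSHF (c : ℕ) (hc : 2 ≤ c) (s : ℕ → ℕ) (hs : ∀ κ, 2 ≤ s κ)
    (root : ∀ κ, ∀ i : Fin (s κ), Fin (s κ - i)) (ζ : ∀ κ, BitVec κ) : SHF :=
  graphSHF (fun κ => layeredGraph (s κ) c (hs κ) hc (root κ))
    (fun κ => List.ofFn (layeredTarget (s κ) c (hs κ) hc (root κ))) ζ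

/-!
The graph is so robust that a black pebbling argument with generous constants works, and the
labels behave so much like independent random strings that an execution can be read as a
pebbling.

*Pebbling.* Let `S` be a set of at most `s / 64` vertices. Some column of the pyramid and most
pairs of consecutive levels avoid `S`. Climbing the column, with a detour along each such pair of
levels, gives a path of `Ω(s ^ 2)` edges that avoids `S` and ends a quarter of the way up
(`BaseVertex.isDeep_column`). From its end complete levels further up are in reach
(`BaseVertex.exists_isDeep_reach_level`). If `S` is the set of pebbles at some time, a vertex at
the end of such a path stays free of pebbles for `Ω(s ^ 2)` steps. This survives from one time
with few pebbles to the next: a path from the lower to the upper levels that is not pebbled in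
between crosses a level that is in reach for the new set of pebbles
(`BaseVertex.isDeep_of_small_step`). So, unless there are many pebbles at `Ω(s ^ 2)` times, a
complete level is never pebbled, nor is the root on it. Each copy of the path `w_1, …, w_{s-1}`
needs that root, hence only those copies that carry a pebble at the start can reach their target
(`ncard_targets_le`). The path `v_1, …, v_{c s}` is not needed for this.

*From executions to pebblings.* A vertex is pebbled at time `i` if its label is used in a correct
query from iteration `i` on before it is asked for. These sets form a pebbling
(`Dag.isPebbling_pebbled`). Given the state at time `i`, short advice, and the oracle except for
the labels of `m` pebbled vertices, one can simulate the execution and read off these labels.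
Hence the oracles with the given state and advice make up a fraction of at most `2 ^ (-κ m)`
(`Dag.card_mul_le_of_lab_eq`), and a union bound over states and advice shows that states with
few bits have few pebbles (`Dag.uniformProb_pebbled_le`). The same argument shows that an
algorithm does not output many labels that it has not asked for (`Dag.uniformProb_outputs_le`).
Finally, `4 s` random indices hit more than half of the `s` words with overwhelming probability
(`uniformProb_card_image_le`), and a correct output reveals the words that are hit; but most of
the targets have not been asked for.

All the failure probabilities are negligible because `s` is at least of the order of
`Δ ∈ ω(log κ)`.
-/

/-! ### Parallel pebbling -/

/-- A parallel black pebbling: `P t` is the set of pebbled vertices at time `t`, and `Q t` is the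
set of vertices that may receive a pebble between the times `t` and `t + 1`; their direct
predecessors have to carry pebbles at time `t`. -/
structure IsPebbling {V : Type} (pred : V → List V) (P Q : ℕ → Set V) : Prop where
  mem_of_pred : ∀ t v, v ∈ Q t → ∀ u ∈ pred v, u ∈ P t
  succ_subset : ∀ t, P (t + 1) ⊆ P t ∪ Q t

/-- `IsDeep pred S d v`: some path with `d` edges ends in `v` and avoids `S`. -/
def IsDeep {V : Type} (pred : V → List V) (S : Set V) : ℕ → V → Prop
  | 0, v => v ∉ S
  | d + 1, v => v ∉ S ∧ ∃ u ∈ pred v, IsDeep pred S d u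

/-- `ReachAvoiding pred S u v`: some path from `u` to `v` avoids `S`, except possibly in `u`. -/
def ReachAvoiding {V : Type} (pred : V → List V) (S : Set V) : V → V → Prop :=
  Relation.ReflTransGen fun u v => u ∈ pred v ∧ v ∉ S

section Pebbling

variable {V : Type} {pred : V → List V} {S S' : Set V} {P Q : ℕ → Set V}

theorem IsDeep.notMem {d : ℕ} {v : V} (h : IsDeep pred S d v) : v ∉ S := by
  cases d with
  | zero => exact h
  | succ d => exact h.1

theorem IsDeep.of_succ {d : ℕ} : ∀ {v : V}, IsDeep pred S (d + 1) v → IsDeep pred S d v := by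
  induction d with
  | zero => exact fun h => h.1
  | succ d ih => exact fun ⟨h, u, hu, hd⟩ => ⟨h, u, hu, ih hd⟩

theorem IsDeep.mono {d e : ℕ} (hde : d ≤ e) {v : V} (h : IsDeep pred S e v) :
    IsDeep pred S d v := by
  induction e, hde using Nat.le_induction with
  | base => exact h
  | succ e _ ih => exact ih h.of_succ

theorem IsDeep.reach {d : ℕ} {u v : V} (h : IsDeep pred S d u)
    (huv : ReachAvoiding pred S u v) : IsDeep pred S d v := by
  induction huv with
  | refl => exact h
  | tail _ hst ih => exact IsDeep.of_succ ⟨hst.2, _, hst.1, ih⟩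

theorem ReachAvoiding.trans {u v w : V} (h : ReachAvoiding pred S u v)
    (h' : ReachAvoiding pred S v w) : ReachAvoiding pred S u w :=
  Relation.ReflTransGen.trans h h'

theorem ReachAvoiding.single {u v : V} (h : u ∈ pred v) (hv : v ∉ S) :
    ReachAvoiding pred S u v :=
  Relation.ReflTransGen.single ⟨h, hv⟩

/-- A path that starts in a deep vertex consists of deep vertices, so it avoids any set without
deep vertices. -/
theorem ReachAvoiding.of_isDeep {d : ℕ} {u v : V} (h : ReachAvoiding pred S u v)
    (hu : IsDeep pred S d u) (hS' : ∀ w, IsDeep pred S d w → w ∉ S') :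
    ReachAvoiding pred S' u v := by
  induction h with
  | refl => exact Relation.ReflTransGen.refl
  | tail h hst ih =>
    exact ih.tail ⟨hst.1, hS' _ (hu.reach (h.tail hst))⟩

/-- Pebbles move by at most one edge in each step. -/
theorem IsPebbling.notMem_of_isDeep (hP : IsPebbling pred P Q) (t : ℕ) :
    ∀ (e d : ℕ) (v : V), IsDeep pred (P t) d v → e ≤ d → v ∉ P (t + e) := by
  intro e
  induction e with
  | zero => exact fun d v h _ => h.notMem
  | succ e ih =>
    intro d v h hed hv
    obtain ⟨d, rfl⟩ : ∃ d', d = d' + 1 := ⟨d - 1, by omega⟩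
    rcases hP.succ_subset (t + e) hv with hv | hv
    · exact ih (d + 1) v h (by omega) hv
    · obtain ⟨_, u, hu, hdu⟩ := h
      exact ih d u hdu (by omega) (hP.mem_of_pred _ _ hv u hu)

end Pebbling

/-! ### Long paths in the pyramid -/

namespace BaseVertex

variable {s c : ℕ}

/-- The level of a vertex. The vertices inside the gadget of `(i, j)` count for level `i - 1`, so
that an edge that raises the level does so by one and ends in a vertex `pyr i j`; the vertices
outside the pyramid have level `0`. -/
def lev : BaseVertex s c → ℕ
  | pyr i _ _ => i
  | bot _ i _ _ => i - 1
  | mid _ i _ _ => i - 1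
  | chain _ _ => 0
  | top _ _ => 0

/-- The row of a vertex of the pyramid, where a gadget lies in the row of its apex. -/
def row : BaseVertex s c → Option ℕ
  | pyr i _ _ => some i
  | bot _ i _ _ => some i
  | mid _ i _ _ => some i
  | chain _ _ => none
  | top _ _ => none

/-- The column of a vertex of the pyramid, where a gadget lies in the column of its apex. -/
def col : BaseVertex s c → Option ℕ
  | pyr _ j _ => some j
  | bot _ _ j _ => some j
  | mid _ _ j _ => some j
  | chain _ _ => none
  | top _ _ => none

variable {hs : 2 ≤ s} {hc : 2 ≤ c} {root : ∀ i : Fin s, Fin (s - i)} {S : Set (BaseVertex s c)}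

theorem lev_cross {b : ℕ} {u v : BaseVertex s c} (huv : u ∈ pred hs hc root v)
    (hu : lev u < b) (hv : b ≤ lev v) : ∃ (j : ℕ) (h : b + j < s), v = pyr b j h := by
  cases v with
  | pyr i j h =>
    have : i ≤ lev u + 1 := by
      simp only [pred] at huv
      split_ifs at huv with h0
      · omega
      · simp at huv
      · simp only [List.mem_cons, List.not_mem_nil, or_false] at huv
        rcases huv with rfl | rfl <;> simp only [lev] <;> omega
      · simp only [List.mem_cons, List.not_mem_nil, or_false] at huv
        rcases huv with rfl | rfl <;> simp only [lev] <;> omega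
    have hib : i = b := by simp only [lev] at hv; omega
    subst hib
    exact ⟨j, h, rfl⟩
  | mid t i j h =>
    simp only [pred, List.mem_cons, List.not_mem_nil, or_false] at huv
    rcases huv with rfl | rfl <;> simp only [lev] at hu hv <;> omega
  | bot t i j h =>
    fin_cases t <;> simp only [pred, List.mem_singleton] at huv <;> subst huv <;>
      simp only [lev] at hu hv <;> omega
  | chain q h => simp only [lev] at hv; omega
  | top l h => simp only [lev] at hv; omega

/-- A path that climbs from below level `b` to level `b` or above meets level `b`. -/
theorem exists_mem_level {b : ℕ} {u v : BaseVertex s c}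
    (h : ReachAvoiding (pred hs hc root) S u v) (hu : lev u < b) (hv : b ≤ lev v) :
    ∃ (j : ℕ) (hj : b + j < s), ReachAvoiding (pred hs hc root) S u (pyr b j hj) ∧
      ReachAvoiding (pred hs hc root) S (pyr b j hj) v := by
  induction h with
  | refl => omega
  | @tail w v h hst ih =>
    by_cases hw : b ≤ lev w
    · obtain ⟨j, hj, h1, h2⟩ := ih hw
      exact ⟨j, hj, h1, h2.tail hst⟩
    · obtain ⟨j, hj, rfl⟩ := lev_cross hst.1 (by omega) hv
      exact ⟨j, hj, h.tail hst, Relation.ReflTransGen.refl⟩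

/-- A step upwards within a column. -/
theorem reach_up {i j : ℕ} (h : i + 1 + j < s)
    (hS : ∀ v ∈ S, col v ≠ some j) :
    ReachAvoiding (pred hs hc root) S (pyr i j (by omega)) (pyr (i + 1) j h) := by
  have hS' : ∀ v : BaseVertex s c, col v = some j → v ∉ S := fun v hv hvS => hS v hvS hv
  by_cases h3 : IsTriple s (i + 1) j
  · refine (ReachAvoiding.single (v := bot 0 (i + 1) j h3) ?_ (hS' _ rfl)).trans
      ((ReachAvoiding.single (v := mid 0 (i + 1) j h3) ?_ (hS' _ rfl)).trans
        (ReachAvoiding.single ?_ (hS' _ rfl))) <;> simp [pred, h3]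
  · exact ReachAvoiding.single (by simp [pred, h3]) (hS' _ rfl)

theorem reach_column {i j : ℕ} (k : ℕ) (h : i + k + j < s)
    (hS : ∀ v ∈ S, col v ≠ some j) :
    ReachAvoiding (pred hs hc root) S (pyr i j (by omega)) (pyr (i + k) j h) := by
  induction k with
  | zero => exact Relation.ReflTransGen.refl
  | succ k ih => exact (ih (by omega)).trans (reach_up (by omega) hS)

/-- A step along the path through a level; it advances by at least one edge. -/
theorem isDeep_along {i j d : ℕ} (h : i + j < s) (h' : i + prevPos i j < s)
    (hfirst : if Even i then 0 < j else i + j + 1 < s)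
    (hS : ∀ v ∈ S, row v ≠ some i)
    (hd : IsDeep (pred hs hc root) S d (pyr i (prevPos i j) h')) :
    IsDeep (pred hs hc root) S (d + 1) (pyr i j h) := by
  have hS' : ∀ v : BaseVertex s c, row v = some i → v ∉ S := fun v hv hvS => hS v hvS hv
  rcases Nat.eq_zero_or_pos i with rfl | hi
  · simp only [Even.zero, if_true] at hfirst
    exact ⟨hS' _ rfl, _, by simp [pred, hfirst], hd⟩
  · have h3 : IsTriple s i j := ⟨hi, h, hfirst⟩
    have : IsDeep (pred hs hc root) S (d + 2) (mid 1 i j h3) :=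
      ⟨hS' _ rfl, bot 2 i j h3, by simp [pred], hS' _ rfl, _, by simp [pred], hd⟩
    exact ⟨hS' _ rfl, _, by simp [pred, h3, show i ≠ 0 by omega], this.mono (by omega)⟩

theorem reach_along {i j : ℕ} (h : i + j < s) (h' : i + prevPos i j < s)
    (hfirst : if Even i then 0 < j else i + j + 1 < s)
    (hS : ∀ v ∈ S, row v ≠ some i) :
    ReachAvoiding (pred hs hc root) S (pyr i (prevPos i j) h') (pyr i j h) := by
  have hS' : ∀ v : BaseVertex s c, row v = some i → v ∉ S := fun v hv hvS => hS v hvS hv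
  rcases Nat.eq_zero_or_pos i with rfl | hi
  · simp only [Even.zero, if_true] at hfirst
    exact ReachAvoiding.single (by simp [pred, hfirst]) (hS' _ rfl)
  · have h3 : IsTriple s i j := ⟨hi, h, hfirst⟩
    refine (ReachAvoiding.single (v := bot 2 i j h3) ?_ (hS' _ rfl)).trans
      ((ReachAvoiding.single (v := mid 1 i j h3) ?_ (hS' _ rfl)).trans
        (ReachAvoiding.single ?_ (hS' _ rfl)))
    · simp [pred]
    · simp [pred]
    · simp [pred, h3, show i ≠ 0 by omega]

end BaseVertex

theorem card_le_card_filter_add_ncard {V : Type} [Finite V] (S : Set V) (g : V → Option ℕ)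
    (T : Finset ℕ) [DecidablePred fun a => ∀ v ∈ S, g v ≠ some a] :
    T.card ≤ (T.filter fun a => ∀ v ∈ S, g v ≠ some a).card + S.ncard := by
  classical
  rw [← Finset.card_filter_add_card_filter_not (s := T) fun a => ∀ v ∈ S, g v ≠ some a]
  gcongr
  rw [Set.ncard_eq_toFinset_card S]
  refine (Finset.card_le_card (t := (S.toFinite.toFinset.image fun v => (g v).getD 0)) ?_).trans
    Finset.card_image_le
  intro a ha
  simp only [Finset.mem_filter, not_forall, not_not] at ha
  obtain ⟨-, v, hv, hva⟩ := ha
  simp only [Finset.mem_image, Set.Finite.mem_toFinset]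
  exact ⟨v, hv, by simp [hva]⟩

theorem exists_mem_forall_ne_of_ncard_lt {V : Type} [Finite V] (S : Set V) (g : V → Option ℕ)
    (T : Finset ℕ) (h : S.ncard < T.card) : ∃ a ∈ T, ∀ v ∈ S, g v ≠ some a := by
  classical
  have := card_le_card_filter_add_ncard S g T
  obtain ⟨a, ha⟩ : (T.filter fun a => ∀ v ∈ S, g v ≠ some a).Nonempty := by
    rw [← Finset.card_pos]
    omega
  exact ⟨a, (Finset.mem_filter.1 ha).1, (Finset.mem_filter.1 ha).2⟩

namespace BaseVertex

variable {s c : ℕ} {hs : 2 ≤ s} {hc : 2 ≤ c} {root : ∀ i : Fin s, Fin (s - i)}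
  {S : Set (BaseVertex s c)}

theorem isDeep_right {a j d : ℕ} (k : ℕ) (h : 2 * a + (j + k) < s)
    (hS : ∀ v ∈ S, row v ≠ some (2 * a))
    (hd : IsDeep (pred hs hc root) S d (pyr (2 * a) j (by omega))) :
    IsDeep (pred hs hc root) S (d + k) (pyr (2 * a) (j + k) h) := by
  induction k with
  | zero => exact hd
  | succ k ih =>
    have h' : prevPos (2 * a) (j + (k + 1)) = j + k := by simp [prevPos]
    refine isDeep_along (d := d + k) h (by rw [h']; omega) (by simp) hS ?_
    simp only [h']
    exact ih (by omega) hd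

theorem reach_right {a j : ℕ} (k : ℕ) (h : 2 * a + (j + k) < s)
    (hS : ∀ v ∈ S, row v ≠ some (2 * a)) :
    ReachAvoiding (pred hs hc root) S (pyr (2 * a) j (by omega)) (pyr (2 * a) (j + k) h) := by
  induction k with
  | zero => exact Relation.ReflTransGen.refl
  | succ k ih =>
    have h' : prevPos (2 * a) (j + (k + 1)) = j + k := by simp [prevPos]
    have := reach_along (hs := hs) (hc := hc) (root := root) h (by rw [h']; omega) (by simp) hS
    simp only [h'] at this
    exact (ih (by omega)).trans this

theorem reach_left {a x : ℕ} (k : ℕ) (h : 2 * a + 1 + (x + k) < s)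
    (hS : ∀ v ∈ S, row v ≠ some (2 * a + 1)) :
    ReachAvoiding (pred hs hc root) S (pyr (2 * a + 1) (x + k) h)
      (pyr (2 * a + 1) x (by omega)) := by
  induction k with
  | zero => exact Relation.ReflTransGen.refl
  | succ k ih =>
    have hodd : ¬ Even (2 * a + 1) := by simp
    have h' : prevPos (2 * a + 1) (x + k) = x + (k + 1) := by simp [prevPos]; omega
    have := reach_along (hs := hs) (hc := hc) (root := root) (i := 2 * a + 1) (j := x + k)
      (by omega) (by rw [h']; omega) (by simp [hodd]; omega) hS
    simp only [h'] at this
    exact this.trans (ih (by omega))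

/-- From the end of level `2 a`, one enters level `2 a + 1` at its end and runs back. -/
theorem reach_turn {a x : ℕ} (h : 2 * a + 1 + x < s)
    (hS : ∀ v ∈ S, row v ≠ some (2 * a + 1)) :
    ReachAvoiding (pred hs hc root) S (pyr (2 * a) (s - 1 - 2 * a) (by omega))
      (pyr (2 * a + 1) x (by omega)) := by
  have hodd : ¬ Even (2 * a + 1) := by simp
  obtain ⟨k, hk⟩ : ∃ k, x + k + 2 * a + 2 = s := ⟨s - (x + 2 * a + 2), by omega⟩
  have h3 : ¬ IsTriple s (2 * a + 1) (x + k) := by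
    simp only [IsTriple, hodd, if_false]
    omega
  refine (ReachAvoiding.single (v := pyr (2 * a + 1) (x + k) (by omega)) ?_ ?_).trans
    (reach_left k (by omega) hS)
  · have : s - 1 - 2 * a = x + k + 1 := by omega
    simp [pred, h3, this]
  · exact fun hv => hS _ hv rfl

theorem reach_pair {a j x : ℕ} (h : 2 * a + 1 + x < s) (hj : 2 * a + j < s)
    (hS : ∀ v ∈ S, row v ≠ some (2 * a)) (hS' : ∀ v ∈ S, row v ≠ some (2 * a + 1)) :
    ReachAvoiding (pred hs hc root) S (pyr (2 * a) j hj) (pyr (2 * a + 1) x h) := by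
  obtain ⟨k, hk⟩ : ∃ k, s - 1 - 2 * a = j + k := ⟨s - 1 - 2 * a - j, by omega⟩
  have := reach_turn (hs := hs) (hc := hc) (root := root) h hS'
  simp only [hk] at this
  exact (reach_right k (by omega) hS).trans this

theorem isDeep_pair {a j d : ℕ} (h : 2 * a + 1 + j < s)
    (hS : ∀ v ∈ S, row v ≠ some (2 * a)) (hS' : ∀ v ∈ S, row v ≠ some (2 * a + 1))
    (hd : IsDeep (pred hs hc root) S d (pyr (2 * a) j (by omega))) :
    IsDeep (pred hs hc root) S (d + (s - 1 - 2 * a - j)) (pyr (2 * a + 1) j h) := by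
  obtain ⟨k, hk⟩ : ∃ k, s - 1 - 2 * a = j + k := ⟨s - 1 - 2 * a - j, by omega⟩
  have := reach_turn (hs := hs) (hc := hc) (root := root) h hS'
  simp only [hk] at this
  exact ((isDeep_right k (by omega) hS hd).mono (by omega)).reach this

/-- The pairs of levels `2 a`, `2 a + 1`, numbered by `a`. -/
def rowPair (v : BaseVertex s c) : Option ℕ := (row v).map (· / 2)

theorem row_ne_of_rowPair_ne {a : ℕ} (hS : ∀ v ∈ S, rowPair v ≠ some a) :
    (∀ v ∈ S, row v ≠ some (2 * a)) ∧ ∀ v ∈ S, row v ≠ some (2 * a + 1) := by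
  constructor <;> intro v hv h <;> refine hS v hv ?_ <;> simp [rowPair, h]
  omega

open Classical in
/-- Climbing a column that avoids `S`, with a detour along each pair of levels that avoids `S`. -/
theorem isDeep_column {j : ℕ} (hj : j < s / 8) (hcol : ∀ v ∈ S, col v ≠ some j) (a : ℕ)
    (ha : a ≤ s / 8) :
    IsDeep (pred hs hc root) S
      (((Finset.range a).filter fun a => ∀ v ∈ S, rowPair v ≠ some a).card * (s / 2))
      (pyr (2 * a) j (by omega)) := by
  induction a with
  | zero =>
    have : (pyr 0 j (by omega) : BaseVertex s c) ∉ S := fun h => hcol _ h rfl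
    simpa [IsDeep] using this
  | succ a ih =>
    have ih := ih (by omega)
    rw [Finset.range_add_one, Finset.filter_insert]
    split_ifs with hfree
    · rw [Finset.card_insert_of_notMem (by simp)]
      obtain ⟨h1, h2⟩ := row_ne_of_rowPair_ne hfree
      refine ((isDeep_pair (by omega) h1 h2 ih).mono ?_).reach
        (reach_up (i := 2 * a + 1) (by omega) hcol)
      rw [Nat.succ_mul]
      omega
    · exact (ih.reach (reach_up (i := 2 * a) (by omega) hcol)).reach
        (reach_up (i := 2 * a + 1) (by omega) hcol)

/-- The number of steps for which a small set of pebbles keeps the upper levels out of reach. -/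
def depth (s : ℕ) : ℕ := s ^ 2 / 100 + 1

/-- For a small set `S` some vertex at a quarter of the height is the end of a long path that
avoids `S`, and from there complete levels in the second and in the third quarter are in reach. -/
theorem exists_isDeep_reach_level (hs' : 1000 ≤ s) (hS : S.ncard ≤ s / 64) :
    ∃ u : BaseVertex s c, lev u = 2 * (s / 8) ∧ IsDeep (pred hs hc root) S (depth s) u ∧
      (∃ b, 2 * (s / 8) < b ∧ b < 4 * (s / 8) ∧
        ∀ x (h : b + x < s), ReachAvoiding (pred hs hc root) S u (pyr b x h)) ∧
      ∃ b, 4 * (s / 8) < b ∧ b < 6 * (s / 8) ∧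
        ∀ x (h : b + x < s), ReachAvoiding (pred hs hc root) S u (pyr b x h) := by
  classical
  obtain ⟨j, hj, hcol⟩ := exists_mem_forall_ne_of_ncard_lt S col (Finset.range (s / 8))
    (by rw [Finset.card_range]; omega)
  rw [Finset.mem_range] at hj
  have hlevel : ∀ k, 1 ≤ k → k ≤ 2 → ∃ b, 2 * k * (s / 8) < b ∧ b < 2 * (k + 1) * (s / 8) ∧
        ∀ x (h : b + x < s), ReachAvoiding (pred hs hc root) S
          (pyr (2 * (s / 8)) j (by omega)) (pyr b x h) := by
    intro k hk1 hk2
    obtain ⟨a, ha, hfree⟩ := exists_mem_forall_ne_of_ncard_lt S rowPair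
      (Finset.Ico (k * (s / 8)) ((k + 1) * (s / 8))) (by
        rw [Nat.card_Ico, Nat.add_mul]
        omega)
    obtain ⟨h1, h2⟩ := row_ne_of_rowPair_ne hfree
    rw [Finset.mem_Ico] at ha
    have e1 : 2 * k * (s / 8) = 2 * (k * (s / 8)) := by ring
    have e2 : 2 * (k + 1) * (s / 8) = 2 * ((k + 1) * (s / 8)) := by ring
    have e3 : (k + 1) * (s / 8) ≤ 3 * (s / 8) := Nat.mul_le_mul_right _ (by omega)
    have e4 : 1 * (s / 8) ≤ k * (s / 8) := Nat.mul_le_mul_right _ hk1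
    refine ⟨2 * a + 1, by omega, by omega, fun x h => ?_⟩
    obtain ⟨m, hm⟩ : ∃ m, 2 * a = 2 * (s / 8) + m := ⟨2 * a - 2 * (s / 8), by omega⟩
    have hcl := reach_column (hs := hs) (hc := hc) (root := root) (i := 2 * (s / 8)) (j := j) m
      (by omega) hcol
    simp only [← hm] at hcl
    exact hcl.trans (reach_pair h (by omega) h1 h2)
  refine ⟨pyr (2 * (s / 8)) j (by omega), rfl, ?_, hlevel 1 le_rfl (by omega),
    hlevel 2 (by omega) le_rfl⟩
  refine (isDeep_column hj hcol (s / 8) le_rfl).mono ?_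
  have hcard := card_le_card_filter_add_ncard S rowPair (Finset.range (s / 8))
  rw [Finset.card_range] at hcard
  -- at least `s / 10` of the `s / 8` pairs avoid `S`, and each detour has length `s / 2`
  refine le_trans ?_ (Nat.mul_le_mul_right (s / 2) (show s / 10 ≤ _ by omega))
  obtain ⟨p, r, hr, hp⟩ : ∃ p r, r < 10 ∧ s = 10 * p + r :=
    ⟨s / 10, s % 10, by omega, by omega⟩
  have h1 : s / 10 = p := by omega
  have h2 : 5 * p ≤ s / 2 := by omega
  rw [h1]
  refine le_trans ?_ (Nat.mul_le_mul_left p h2)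
  have : s ^ 2 / 100 < (p + 1) ^ 2 := by
    rw [Nat.div_lt_iff_lt_mul (by norm_num)]
    nlinarith
  simp only [depth]
  nlinarith

/-- Let `v` be reachable from a deep vertex of the lower levels. Then this remains true until the
next time with few pebbles: the path to `v` consists of deep vertices, so it is not pebbled in
between, and it crosses a level that is in reach of a new deep vertex. -/
theorem isDeep_of_small_step {P Q : ℕ → Set (BaseVertex s c)}
    (hP : IsPebbling (pred hs hc root) P Q) (hs' : 1000 ≤ s) {t e : ℕ} (he : e ≤ depth s)
    (hsmall : (P (t + e)).ncard ≤ s / 64) {v : BaseVertex s c} (hv : 4 * (s / 8) ≤ lev v)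
    (h : ∃ u, lev u ≤ 2 * (s / 8) ∧ IsDeep (pred hs hc root) (P t) (depth s) u ∧
      ReachAvoiding (pred hs hc root) (P t) u v) :
    ∃ u, lev u ≤ 2 * (s / 8) ∧ IsDeep (pred hs hc root) (P (t + e)) (depth s) u ∧
      ReachAvoiding (pred hs hc root) (P (t + e)) u v := by
  obtain ⟨u, hu, hdeep, hreach⟩ := h
  obtain ⟨u', hu', hdeep', ⟨b, hb1, hb2, hb⟩, -⟩ :=
    exists_isDeep_reach_level (hs := hs) (hc := hc) (root := root) hs' hsmall
  obtain ⟨x, hx, h1, h2⟩ := exists_mem_level (b := b) hreach (by omega) (by omega)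
  refine ⟨u', hu'.le, hdeep', (hb x hx).trans ?_⟩
  exact h2.of_isDeep (hdeep.reach h1) fun w hw => hP.notMem_of_isDeep t e _ w hw he

/-- If a pebbling has few pebbles at the start, and many pebbles at few times only, then a
complete level in the upper half of the pyramid is never pebbled. -/
theorem exists_level_notMem {P Q : ℕ → Set (BaseVertex s c)}
    (hP : IsPebbling (pred hs hc root) P Q) (hs' : 1000 ≤ s) (h0 : (P 0).ncard ≤ s / 64)
    (hlarge : {t | s / 64 < (P t).ncard}.encard < depth s) :
    ∃ b, 1 ≤ b ∧ b < s ∧ ∀ t x (h : b + x < s), pyr b x h ∉ P t := by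
  obtain ⟨u, hu, hdeep, -, b, hb1, hb2, hb⟩ :=
    exists_isDeep_reach_level (hs := hs) (hc := hc) (root := root) hs' h0
  refine ⟨b, by omega, by omega, fun t x h => ?_⟩
  -- the last time before `t` with few pebbles is at most `depth s` steps ago
  have hlast : ∀ t, ∃ t₀ e, t = t₀ + e ∧ e ≤ depth s ∧ (P t₀).ncard ≤ s / 64 ∧
      (0 < t → t₀ < t) := by
    intro t
    by_contra! hcon
    have hsub : ∀ i, i < t → t ≤ i + depth s → s / 64 < (P i).ncard := by
      intro i hi hti
      by_contra! hle
      exact absurd (hcon i (t - i) (by omega) (by omega) hle).2 (by omega)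
    rcases Nat.lt_or_ge t (depth s + 1) with ht | ht
    · rcases Nat.eq_zero_or_pos t with rfl | htpos
      · exact absurd (hcon 0 0 rfl (by omega) h0).1 (by omega)
      · exact absurd (hcon 0 t (by omega) (by omega) h0).2 (by omega)
    · have h1 : (↑(Finset.Ico (t - depth s) t) : Set ℕ) ⊆ {t | s / 64 < (P t).ncard} := by
        intro i hi
        rw [Finset.mem_coe, Finset.mem_Ico] at hi
        exact hsub i hi.2 (by omega)
      have h2 := Set.encard_le_encard h1
      rw [Set.encard_coe_eq_coe_finsetCard, Nat.card_Ico,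
        show t - (t - depth s) = depth s by omega] at h2
      exact absurd (h2.trans_lt hlarge) (lt_irrefl _)
  have hinv : ∀ t, (P t).ncard ≤ s / 64 →
      ∃ u, lev u ≤ 2 * (s / 8) ∧ IsDeep (pred hs hc root) (P t) (depth s) u ∧
        ReachAvoiding (pred hs hc root) (P t) u (pyr b x h) := by
    intro t
    induction t using Nat.strong_induction_on with
    | _ t ih =>
      intro hsmall
      rcases Nat.eq_zero_or_pos t with rfl | htpos
      · exact ⟨u, hu.le, hdeep, hb x h⟩
      · obtain ⟨t₀, e, rfl, he, hsmall₀, hlt⟩ := hlast t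
        exact isDeep_of_small_step hP hs' he hsmall (by simp only [lev]; omega)
          (ih t₀ (hlt htpos) hsmall₀)
  obtain ⟨t₀, e, rfl, he, hsmall, -⟩ := hlast t
  obtain ⟨u, -, hdeep, hreach⟩ := hinv t₀ hsmall
  exact hP.notMem_of_isDeep t₀ e _ _ (hdeep.reach hreach) he

end BaseVertex

/-! ### The layered graph -/

instance (G : Dag) : Finite G.V := G.finite

section Layered

variable {s c : ℕ} {hs : 2 ≤ s} {hc : 2 ≤ c} {root : ∀ i : Fin s, Fin (s - i)}

theorem mem_pred_layeredGraph (x y : (layeredGraph s c hs hc root).V) :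
    x ∈ (layeredGraph s c hs hc root).pred y ↔
      (x.1.1 : BaseVertex s c) ∈ BaseVertex.pred hs hc root y.1.1 ∧
        ((x.1.1 : BaseVertex s c) ∈ BaseVertex.copied root ∧ x.1.2 = y.1.2 ∨
          (x.1.1 : BaseVertex s c) ∉ BaseVertex.copied root ∧ x.1.2 = 0) :=
  Dag.mem_pred_layer _ _ _ x y

/-- The vertex of the base graph of which `x` is a copy. -/
def layeredProj (x : (layeredGraph s c hs hc root).V) : BaseVertex s c := x.1.1

theorem exists_mem_pred_layeredProj (y : (layeredGraph s c hs hc root).V) {u : BaseVertex s c}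
    (hu : u ∈ BaseVertex.pred hs hc root (layeredProj y)) :
    ∃ x ∈ (layeredGraph s c hs hc root).pred y, layeredProj x = u := by
  by_cases hC : u ∈ BaseVertex.copied root
  · exact ⟨⟨(u, y.1.2), y.2.1, Or.inr hC⟩,
      (mem_pred_layeredGraph _ _).2 ⟨hu, Or.inl ⟨hC, rfl⟩⟩, rfl⟩
  · exact ⟨⟨(u, 0), Nat.zero_lt_of_lt y.2.1, Or.inl rfl⟩,
      (mem_pred_layeredGraph _ _).2 ⟨hu, Or.inr ⟨hC, rfl⟩⟩, rfl⟩

/-- Forgetting the copies turns a pebbling of the layered graph into one of the base graph. -/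
theorem IsPebbling.layeredProj {P Q : ℕ → Set (layeredGraph s c hs hc root).V}
    (hP : IsPebbling (layeredGraph s c hs hc root).pred P Q) :
    IsPebbling (BaseVertex.pred hs hc root) (fun t => layeredProj '' P t)
      (fun t => layeredProj '' Q t) where
  mem_of_pred := by
    rintro t _ ⟨y, hy, rfl⟩ u hu
    obtain ⟨x, hx, rfl⟩ := exists_mem_pred_layeredProj y hu
    exact ⟨x, hP.mem_of_pred t y hy x hx, rfl⟩
  succ_subset := by
    rintro t _ ⟨y, hy, rfl⟩
    rcases hP.succ_subset t hy with h | h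
    · exact Or.inl ⟨y, h, rfl⟩
    · exact Or.inr ⟨y, h, rfl⟩

/-- The copy of `w_{l+1}` with number `k`. -/
def layeredTop (s c : ℕ) (hs : 2 ≤ s) (hc : 2 ≤ c) (root : ∀ i : Fin s, Fin (s - i))
    (l : ℕ) (hl : l + 1 < s) (k : ℕ) (hk : k < s) : (layeredGraph s c hs hc root).V :=
  ⟨(BaseVertex.top l hl, k), hk, Or.inr (Or.inr (Or.inr ⟨l, hl, rfl⟩))⟩

theorem layeredTop_mem_pred (l : ℕ) (hl : l + 2 < s) (k : ℕ) (hk : k < s) :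
    layeredTop s c hs hc root l (by omega) k hk ∈
      (layeredGraph s c hs hc root).pred (layeredTop s c hs hc root (l + 1) hl k hk) := by
  refine (mem_pred_layeredGraph _ _).2 ⟨?_, Or.inl ⟨Or.inr (Or.inr ⟨l, by omega, rfl⟩), rfl⟩⟩
  simp only [layeredTop, BaseVertex.pred, Nat.add_one_ne_zero, if_false]
  exact List.mem_cons_self

/-- If a complete level of the pyramid is never pebbled, then no copy of the path
`w_1, …, w_{s-1}` gets past that level, unless it carries a pebble beyond it at the start. -/
theorem exists_layeredTop_mem_zero {P Q : ℕ → Set (layeredGraph s c hs hc root).V}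
    (hP : IsPebbling (layeredGraph s c hs hc root).pred P Q) {b : ℕ} (hb1 : 1 ≤ b) (hbs : b < s)
    (hb : ∀ t x (h : b + x < s), BaseVertex.pyr b x h ∉ layeredProj '' P t)
    {t : ℕ} {k : Fin s} (hk : layeredTarget s c hs hc root k ∈ Q t) :
    ∃ l, ∃ hl : l + 1 < s, layeredTop s c hs hc root l hl k k.2 ∈ P 0 := by
  by_contra! hcon
  have hQ : ∀ t, (∀ l (hl : l + 1 < s), b ≤ l + 1 → layeredTop s c hs hc root l hl k k.2 ∉ P t) →
      ∀ l (hl : l + 1 < s), b ≤ l + 1 → layeredTop s c hs hc root l hl k k.2 ∉ Q t := by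
    intro t hPt l hl hbl hmem
    rcases Nat.eq_or_lt_of_le hbl with hbl' | hbl'
    · have hpred : BaseVertex.rootAt root (l + 1) hl ∈
          BaseVertex.pred hs hc root (BaseVertex.top (c := c) l hl) := by
        simp only [BaseVertex.pred]
        split_ifs with h0
        · subst h0
          simp
        · simp
      have := hP.layeredProj.mem_of_pred t _ ⟨_, hmem, rfl⟩ _ hpred
      subst hbl'
      exact hb t _ _ this
    · obtain ⟨l, rfl⟩ : ∃ l', l = l' + 1 := ⟨l - 1, by omega⟩
      exact hPt l (by omega) (by omega)
        (hP.mem_of_pred t _ hmem _ (layeredTop_mem_pred l hl k k.2))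
  have hPt : ∀ t l (hl : l + 1 < s), b ≤ l + 1 →
      layeredTop s c hs hc root l hl k k.2 ∉ P t := by
    intro t
    induction t with
    | zero => exact fun l hl _ => hcon l hl
    | succ t ih =>
      intro l hl hbl hmem
      rcases hP.succ_subset t hmem with h | h
      · exact ih l hl hbl h
      · exact hQ t ih l hl hbl h
  exact hQ t (hPt t) (s - 2) (by omega) (by omega) hk

/-- If a pebbling of the layered graph has few pebbles at the start, and many pebbles at few
times only, then it reaches at most as many targets as it has pebbles at the start. -/
theorem ncard_targets_le {P Q : ℕ → Set (layeredGraph s c hs hc root).V}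
    (hP : IsPebbling (layeredGraph s c hs hc root).pred P Q) (hs' : 1000 ≤ s)
    (h0 : (P 0).ncard ≤ s / 64)
    (hlarge : {t | s / 64 < (P t).ncard}.encard < BaseVertex.depth s) :
    {k : Fin s | ∃ t, layeredTarget s c hs hc root k ∈ Q t}.ncard ≤ s / 64 := by
  have hproj : ∀ t, (layeredProj '' P t).ncard ≤ (P t).ncard :=
    fun t => Set.ncard_image_le (P t).toFinite
  obtain ⟨b, hb1, hbs, hb⟩ := BaseVertex.exists_level_notMem hP.layeredProj hs'
    ((hproj 0).trans h0)
    ((Set.encard_le_encard fun t (ht : _ < _) => lt_of_lt_of_le ht (hproj t)).trans_lt hlarge)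
  refine le_trans ?_ h0
  have hex : ∀ k : Fin s, (∃ t, layeredTarget s c hs hc root k ∈ Q t) →
      ∃ l, ∃ hl : l + 1 < s, layeredTop s c hs hc root l hl k k.2 ∈ P 0 :=
    fun k ⟨t, hk⟩ => exists_layeredTop_mem_zero hP hb1 hbs hb hk
  choose! l hl hmem using hex
  refine Set.ncard_le_ncard_of_injOn
    (fun k => if h : l k + 1 < s then layeredTop s c hs hc root (l k) h k k.2
      else layeredTarget s c hs hc root k) ?_ ?_ (P 0).toFinite
  · intro k hk
    simp only [dif_pos (hl k hk)]
    exact hmem k hk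
  · intro k hk k' hk' h
    simp only [dif_pos (hl k hk), dif_pos (hl k' hk')] at h
    exact Fin.ext (congrArg (fun x => x.1.2) h)

/-! ### The number of vertices -/

theorem card_layeredGraph_le :
    Nat.card (layeredGraph s c hs hc root).V ≤ (c + 9) * s ^ 2 := by
  have hcs : ∀ q, q < c * s → q / s < c := fun q hq => Nat.div_lt_of_lt_mul (by rwa [mul_comm])
  -- a tag for the kind of the vertex, and two coordinates; a copied root is known by its level
  let f : (layeredGraph s c hs hc root).V → ℕ × ℕ × ℕ := fun x =>
    match x with
    | ⟨(.pyr i j _, k), _⟩ => if k = 0 then (0, i, j) else (1, i, k)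
    | ⟨(.bot t i j _, _), _⟩ => (2 + t, i, j)
    | ⟨(.mid t i j _, _), _⟩ => (5 + t, i, j)
    | ⟨(.top l _, k), _⟩ => (7, l, k)
    | ⟨(.chain q _, k), _⟩ => if k = 0 then (9 + q / s, q % s, 0) else (8, 0, k)
  have hf : ∀ x, f x ∈ (Finset.range (c + 9) ×ˢ Finset.range s ×ˢ Finset.range s) := by
    rintro ⟨⟨v, k⟩, hk, hv⟩
    simp only [Finset.mem_product, Finset.mem_range]
    cases v with
    | pyr i j h => simp only [f]; split_ifs <;> simp only <;> omega
    | bot t i j h => have := h.2.1; simp only [f]; omega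
    | mid t i j h => have := h.2.1; simp only [f]; omega
    | top l h => simp only [f]; simp only at hk; omega
    | chain q h =>
      have := hcs q h
      have := Nat.mod_lt q (show 0 < s by omega)
      simp only [f]
      split_ifs <;> simp only <;> omega
  have hinj : Function.Injective f := by
    rintro ⟨⟨v, k⟩, hk, hv⟩ ⟨⟨v', k'⟩, hk', hv'⟩ h
    have hpyr : ∀ i j h, (BaseVertex.pyr i j h : BaseVertex s c) ∈ BaseVertex.copied root →
        ∃ hi : i < s, j = root ⟨i, hi⟩ := by
      rintro i j h (⟨i', h', -, he⟩ | ⟨_, _, _, he⟩ | ⟨_, _, he⟩)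
      · simp only [BaseVertex.rootAt, BaseVertex.pyr.injEq] at he
        obtain ⟨rfl, rfl⟩ := he
        exact ⟨h', rfl⟩
      · cases he
      · cases he
    have hchain : ∀ q h, (BaseVertex.chain q h : BaseVertex s c) ∈ BaseVertex.copied root →
        q + 1 = c * s := by
      rintro q h (⟨i', h', -, he⟩ | ⟨_, _, hq, he⟩ | ⟨_, _, he⟩)
      · cases he
      · cases he
        exact hq
      · cases he
    have hbot : ∀ t i j h, (BaseVertex.bot t i j h : BaseVertex s c) ∉
        BaseVertex.copied root := by
      simp [BaseVertex.copied, BaseVertex.rootAt]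
    have hmid : ∀ t i j h, (BaseVertex.mid t i j h : BaseVertex s c) ∉
        BaseVertex.copied root := by
      simp [BaseVertex.copied, BaseVertex.rootAt]
    refine Subtype.ext ?_
    change ((v, k) : BaseVertex s c × ℕ) = (v', k')
    simp only at hv hv' hk hk'
    cases v <;> cases v' <;> simp only [f] at h <;> (try split_ifs at h) <;>
      simp only [Prod.mk.injEq] at h <;>
      first
      | exact absurd h.1 (by omega)
      | exact absurd h.1 (by generalize _ / s = z; omega)
      | skip
    · rename_i hk0 hk0'
      obtain ⟨-, rfl, rfl⟩ := h
      subst hk0 hk0'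
      rfl
    · rename_i hk0 _
      obtain ⟨-, rfl, rfl⟩ := h
      obtain ⟨_, e⟩ := hpyr _ _ _ (hv.resolve_left hk0)
      obtain ⟨_, e'⟩ := hpyr _ _ _ (hv'.resolve_left hk0)
      exact Prod.ext (BaseVertex.pyr.injEq .. ▸ ⟨rfl, e.trans e'.symm⟩) rfl
    · rename_i t _ _ _ t' _ _ _
      obtain ⟨h, rfl, rfl⟩ := h
      obtain rfl : t = t' := Fin.ext (by omega)
      rw [hv.resolve_right (hbot _ _ _ _), hv'.resolve_right (hbot _ _ _ _)]
      rfl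
    · rename_i t _ _ _ t' _ _ _
      obtain ⟨h, rfl, rfl⟩ := h
      obtain rfl : t = t' := Fin.ext (by omega)
      rw [hv.resolve_right (hmid _ _ _ _), hv'.resolve_right (hmid _ _ _ _)]
      rfl
    · rename_i q _ q' _ hk0 hk0'
      have e : q / s = q' / s := Nat.add_left_cancel h.1
      obtain rfl : q = q' := by rw [← Nat.div_add_mod q s, e, h.2.1, Nat.div_add_mod]
      subst hk0 hk0'
      rfl
    · rename_i q _ q' _ hk0 _
      obtain ⟨-, -, rfl⟩ := h
      have e := hchain _ _ (hv.resolve_left hk0)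
      have e' := hchain _ _ (hv'.resolve_left hk0)
      obtain rfl : q = q' := by omega
      rfl
    · obtain ⟨-, rfl, rfl⟩ := h
      rfl
  have := Nat.card_le_card_of_injective
    (fun x => (⟨f x, hf x⟩ : (Finset.range (c + 9) ×ˢ Finset.range s ×ˢ Finset.range s : Finset _)))
    (fun x y h => hinj (congrArg Subtype.val h))
  refine this.trans (le_of_eq ?_)
  rw [Nat.card_eq_fintype_card, Fintype.card_coe]
  simp only [Finset.card_product, Finset.card_range]
  ring

theorem le_card_layeredGraph :
    s ^ 2 ≤ 4 * Nat.card (layeredGraph s c hs hc root).V := by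
  have := Nat.card_le_card_of_injective
    (fun x : Fin ((s + 1) / 2) × Fin ((s + 1) / 2) =>
      show (layeredGraph s c hs hc root).V from
        ⟨(BaseVertex.pyr x.1 x.2 (by omega), 0), by omega, Or.inl rfl⟩) (by
      rintro ⟨a, b⟩ ⟨a', b'⟩ h
      have h : (BaseVertex.pyr a b _ : BaseVertex s c) = BaseVertex.pyr a' b' _ :=
        congrArg layeredProj h
      simp only [BaseVertex.pyr.injEq] at h
      exact Prod.ext (Fin.ext h.1) (Fin.ext h.2))
  rw [Nat.card_prod, Nat.card_eq_fintype_card, Fintype.card_fin] at this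
  have h2 : s ≤ 2 * ((s + 1) / 2) := by omega
  nlinarith

end Layered

/-! ### Executions of oracle algorithms -/

namespace PROMAlg

variable {Q A C Y : Type} (B : PROMAlg Q A C Y) (O : Q → A) (ρ : C) (x : List Bool)

/-- In iteration `j` the query `q` is asked. -/
def AsksAt (j : ℕ) (q : Q) : Prop :=
  (B.run O ρ x j).halted = false ∧ q ∈ B.batch j ρ (B.run O ρ x j).state

variable {B O ρ x}

theorem run_eq_of_halted {i j : ℕ} (hij : i ≤ j) (h : (B.run O ρ x i).halted = true) :
    B.run O ρ x j = B.run O ρ x i := by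
  induction j, hij using Nat.le_induction with
  | base => rfl
  | succ j _ ih =>
    rw [run]
    simp [ih, h]

theorem halted_eq_false_of_le {i j : ℕ} (hij : i ≤ j) (h : (B.run O ρ x j).halted = false) :
    (B.run O ρ x i).halted = false := by
  by_contra hi
  rw [Bool.not_eq_false] at hi
  rw [run_eq_of_halted hij hi, hi] at h
  cases h

/-- If two executions agree at time `i`, and get the same answers as long as they agree, then they
agree from time `i` on. -/
theorem run_congr {O₁ O₂ : Q → A} {x₁ x₂ : List Bool} {i : ℕ}
    (hstate : (B.run O₁ ρ x₁ i).state = (B.run O₂ ρ x₂ i).state)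
    (hhalted : (B.run O₁ ρ x₁ i).halted = (B.run O₂ ρ x₂ i).halted)
    (h : ∀ j, i ≤ j →
      (∀ j', i ≤ j' → j' ≤ j → (B.run O₁ ρ x₁ j').state = (B.run O₂ ρ x₂ j').state ∧
        (B.run O₁ ρ x₁ j').halted = (B.run O₂ ρ x₂ j').halted) →
      ∀ q, B.AsksAt O₁ ρ x₁ j q → O₁ q = O₂ q) (j : ℕ) (hj : i ≤ j) :
    (B.run O₁ ρ x₁ j).state = (B.run O₂ ρ x₂ j).state ∧
      (B.run O₁ ρ x₁ j).halted = (B.run O₂ ρ x₂ j).halted ∧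
      ((B.run O₁ ρ x₁ i).out = (B.run O₂ ρ x₂ i).out →
        (B.run O₁ ρ x₁ j).out = (B.run O₂ ρ x₂ j).out) := by
  induction j using Nat.strong_induction_on with
  | _ j ih =>
    rcases Nat.eq_or_lt_of_le hj with rfl | hlt
    · exact ⟨hstate, hhalted, id⟩
    obtain ⟨j, rfl⟩ : ∃ j', j = j' + 1 := ⟨j - 1, by omega⟩
    obtain ⟨h1, h2, h3⟩ := ih j (by omega) (by omega)
    by_cases hh : (B.run O₁ ρ x₁ j).halted = true
    · have hh' := h2 ▸ hh
      rw [run_eq_of_halted (Nat.le_succ j) hh, run_eq_of_halted (Nat.le_succ j) hh']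
      exact ⟨h1, h2, h3⟩
    · have hh' := h2 ▸ hh
      have hans : (B.batch j ρ (B.run O₁ ρ x₁ j).state).map O₁ =
          (B.batch j ρ (B.run O₂ ρ x₂ j).state).map O₂ := by
        rw [← h1]
        refine List.map_congr_left fun q hq => h j (by omega) (fun j' h4 h5 => ?_) q
          ⟨by simpa using hh, hq⟩
        exact ⟨(ih j' (by omega) h4).1, (ih j' (by omega) h4).2.1⟩
      rw [h1] at hans
      simp only [run, if_neg hh, if_neg hh', hans, h1]
      exact ⟨trivial, trivial, fun h => by rw [h3 h]⟩

theorem Outputs.of_le {S : Set Y} (h : B.Outputs O ρ x S) :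
    ∃ i, ∀ j, i ≤ j → {y | y ∈ (B.run O ρ x j).out} = S := by
  obtain ⟨i, hi, hS⟩ := h
  exact ⟨i, fun j hj => by rw [run_eq_of_halted hj hi, hS]⟩

theorem RunsWithin.lt_of_halted_eq_false {T j : ℕ} (h : B.RunsWithin O ρ x T)
    (hj : (B.run O ρ x j).halted = false) : j < T := by
  by_contra! hle
  have := halted_eq_false_of_le hle hj
  rw [h.1] at this
  cases this

theorem RunsWithin.exists_getElem? {T j : ℕ} (h : B.RunsWithin O ρ x T) {q : Q}
    (hq : B.AsksAt O ρ x j q) :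
    j < T ∧ ∃ p < T, (B.batch j ρ (B.run O ρ x j).state)[p]? = some q := by
  have hj := h.lt_of_halted_eq_false hq.1
  obtain ⟨p, hp⟩ := List.mem_iff_getElem?.1 hq.2
  exact ⟨hj, p, (List.getElem?_eq_some_iff.1 hp).1.trans_le (h.2 j hj hq.1), hp⟩

end PROMAlg

/-! ### The pebbling of an execution -/

namespace Dag

variable (G : Dag) {κ : ℕ} (ζ : BitVec κ) (O : (G.V × LabelTuple κ) ⊕ BitVec κ → BitVec κ)

/-- The label of a vertex under an oracle that also answers the queries of the hash function. -/
noncomputable def lab (v : G.V) : BitVec κ := G.label (fun a => O (Sum.inl a)) ζ v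

/-- The tuple of labels that the label of `v` is computed from. -/
noncomputable def inputTuple (v : G.V) : LabelTuple κ :=
  LabelTuple.ofList ζ ((G.pred v).map (G.lab ζ O)) (by simpa using G.length_pred v)

/-- The oracle query whose answer is the label of `v`. -/
noncomputable def correctQuery (v : G.V) : (G.V × LabelTuple κ) ⊕ BitVec κ :=
  Sum.inl (v, G.inputTuple ζ O v)

theorem lab_eq (v : G.V) : G.lab ζ O v = O (G.correctQuery ζ O v) :=
  G.label_eq _ _ _

variable {G ζ O}

theorem eq_of_correctQuery_eq {O₁ O₂ : (G.V × LabelTuple κ) ⊕ BitVec κ → BitVec κ} {v w : G.V}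
    (h : G.correctQuery ζ O₁ v = G.correctQuery ζ O₂ w) :
    v = w ∧ G.inputTuple ζ O₁ v = G.inputTuple ζ O₂ w := by
  simpa [correctQuery] using h

theorem exists_getElem?_inputTuple {u v : G.V} (h : u ∈ G.pred v) :
    ∃ i : Fin 2, (G.inputTuple ζ O v).1[(i : ℕ)]? = some (G.lab ζ O u) := by
  have hmem : G.lab ζ O u ∈ (G.pred v).map (G.lab ζ O) := List.mem_map_of_mem h
  have hval : (G.inputTuple ζ O v).1 = (G.pred v).map (G.lab ζ O) := by
    rw [inputTuple, LabelTuple.ofList, dif_neg (List.ne_nil_of_mem hmem)]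
  obtain ⟨i, hi⟩ := List.mem_iff_getElem?.1 hmem
  have hlen := (List.getElem?_eq_some_iff.1 hi).1
  rw [List.length_map] at hlen
  exact ⟨⟨i, hlen.trans_le (G.length_pred v)⟩, by rw [hval]; exact hi⟩

section Execution

variable (G ζ O) {C Y : Type} (B : PROMAlg ((G.V × LabelTuple κ) ⊕ BitVec κ) (BitVec κ) C Y)
  (ρ : C) (x : List Bool)

/-- The vertices that are pebbled at time `i` of an execution: those whose label is used in a
correct query from iteration `i` on, before it is itself asked for in that period. -/
def pebbled (i : ℕ) : Set G.V :=
  {u | ∃ j, i ≤ j ∧ (∃ v, u ∈ G.pred v ∧ B.AsksAt O ρ x j (G.correctQuery ζ O v)) ∧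
    ∀ j', i ≤ j' → j' < j → ¬ B.AsksAt O ρ x j' (G.correctQuery ζ O u)}

/-- The vertices whose correct query is asked in iteration `i`. -/
def asked (i : ℕ) : Set G.V := {v | B.AsksAt O ρ x i (G.correctQuery ζ O v)}

theorem isPebbling_pebbled :
    IsPebbling G.pred (G.pebbled ζ O B ρ x) (G.asked ζ O B ρ x) where
  mem_of_pred t v hv u hu := ⟨t, le_rfl, ⟨v, hu, hv⟩, fun j' h1 h2 => absurd h2 (by omega)⟩
  succ_subset := by
    rintro t u ⟨j, hj, huse, hnot⟩
    by_cases hu : u ∈ G.asked ζ O B ρ x t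
    · exact Or.inr hu
    · refine Or.inl ⟨j, by omega, huse, fun j' h1 h2 => ?_⟩
      rcases Nat.eq_or_lt_of_le h1 with rfl | h1
      · exact hu
      · exact hnot j' h1 h2

theorem pebbled_eq_empty_of_halted {i : ℕ} (h : (B.run O ρ x i).halted = true) :
    G.pebbled ζ O B ρ x i = ∅ := by
  refine Set.eq_empty_of_forall_notMem ?_
  rintro u ⟨j, hj, ⟨v, -, hv⟩, -⟩
  have := PROMAlg.halted_eq_false_of_le hj hv.1
  rw [h] at this
  cases this

end Execution

end Dag

/-! ### Counting oracles -/

instance (κ : ℕ) : Finite (LabelTuple κ) :=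
  ((List.finite_length_le (BitVec κ) 2).subset fun _ hl => hl.2).to_subtype

theorem natCard_bitVec (κ : ℕ) : Nat.card (BitVec κ) = 2 ^ κ := by
  rw [Nat.card_congr (⟨BitVec.toFin, BitVec.ofFin, fun _ => rfl, fun _ => rfl⟩ :
    BitVec κ ≃ Fin (2 ^ κ)), Nat.card_eq_fintype_card, Fintype.card_fin]

open Classical in
/-- Suppose that, for the oracles in `E`, the labels of `m` given vertices are determined by the
oracle without the answers to the correct queries for these vertices. Then these `m` answers can
be overwritten by arbitrary values without loss of information, so that `E` contains at most a
fraction of `2 ^ (-κ m)` of all oracles. -/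
theorem Dag.card_mul_le_of_lab_eq (G : Dag) {κ m : ℕ} (ζ : BitVec κ) {g : Fin m → G.V}
    (hg : Function.Injective g) (E : Set ((G.V × LabelTuple κ) ⊕ BitVec κ → BitVec κ))
    (hE : ∀ O₁ ∈ E, ∀ O₂ ∈ E, ∀ O : (G.V × LabelTuple κ) ⊕ BitVec κ → BitVec κ,
      (∀ q, (∀ l, q ≠ G.correctQuery ζ O₁ (g l)) → O₁ q = O q) →
      (∀ q, (∀ l, q ≠ G.correctQuery ζ O₂ (g l)) → O₂ q = O q) →
      ∀ l, G.lab ζ O₁ (g l) = G.lab ζ O₂ (g l)) :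
    Nat.card E * (2 ^ κ) ^ m ≤
      Nat.card ((G.V × LabelTuple κ) ⊕ BitVec κ → BitVec κ) := by
  let F : E × (Fin m → BitVec κ) → (G.V × LabelTuple κ) ⊕ BitVec κ → BitVec κ := fun p q =>
    if h : ∃ l, q = G.correctQuery ζ p.1 (g l) then p.2 h.choose else p.1.1 q
  have hF : ∀ p q, (∀ l, q ≠ G.correctQuery ζ p.1.1 (g l)) → p.1.1 q = F p q := by
    intro p q h
    simp only [F]
    rw [dif_neg (by simpa using h)]
  have hF' : ∀ p l, F p (G.correctQuery ζ p.1.1 (g l)) = p.2 l := by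
    intro p l
    have h : ∃ l', G.correctQuery ζ p.1.1 (g l) = G.correctQuery ζ p.1.1 (g l') := ⟨l, rfl⟩
    simp only [F]
    rw [dif_pos h]
    exact congrArg p.2 (hg (eq_of_correctQuery_eq h.choose_spec).1).symm
  have hinj : Function.Injective F := by
    rintro ⟨O₁, a₁⟩ ⟨O₂, a₂⟩ h
    have hlabg := hE O₁ O₁.2 O₂ O₂.2 (F (O₁, a₁)) (hF (O₁, a₁)) (h ▸ hF (O₂, a₂))
    have hinput : ∀ v, (∀ u ∈ G.pred v, G.lab ζ O₁.1 u = G.lab ζ O₂.1 u) →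
        G.correctQuery ζ O₁.1 v = G.correctQuery ζ O₂.1 v := by
      intro v hv
      simp only [correctQuery, inputTuple]
      congr 3
      exact List.map_congr_left hv
    have hlab : ∀ v, G.lab ζ O₁.1 v = G.lab ζ O₂.1 v := by
      intro v
      induction v using G.wf.induction with
      | _ v ih =>
        by_cases hv : ∃ l, v = g l
        · obtain ⟨l, rfl⟩ := hv
          exact hlabg l
        · push Not at hv
          have hne : ∀ (O₁ O₂ : (G.V × LabelTuple κ) ⊕ BitVec κ → BitVec κ) l,
              G.correctQuery ζ O₁ v ≠ G.correctQuery ζ O₂ (g l) :=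
            fun O₁ O₂ l h => hv l (eq_of_correctQuery_eq h).1
          rw [lab_eq, lab_eq, ← hinput v ih, hF (O₁, a₁) _ (hne _ _), h,
            ← hF (O₂, a₂) _ (hne _ _)]
    have hcq := fun v => hinput v fun u _ => hlab u
    have hO : O₁ = O₂ := by
      refine Subtype.ext (funext fun q => ?_)
      by_cases hq : ∃ l, q = G.correctQuery ζ O₁.1 (g l)
      · obtain ⟨l, rfl⟩ := hq
        rw [← G.lab_eq ζ O₁.1, hcq, ← G.lab_eq ζ O₂.1, hlab]
      · push Not at hq
        rw [hF (O₁, a₁) q hq, h, ← hF (O₂, a₂) q fun l => hcq (g l) ▸ hq l]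
    subst hO
    refine Prod.ext rfl (funext fun l => ?_)
    rw [← hF' (O₁, a₁) l, h, ← hF' (O₁, a₂) l]
  have := Nat.card_le_card_of_injective F hinj
  rwa [Nat.card_prod, Nat.card_fun, Nat.card_eq_fintype_card (α := Fin m), Fintype.card_fin,
    natCard_bitVec] at this

/-! ### Uniform probabilities -/

section UniformProb

variable {Ω Ω' ι : Type}

theorem uniformProb_le_of_card_mul_le {E : Set Ω} {a : ℝ} (ha : 0 < a)
    (h : (Nat.card E : ℝ) * a ≤ Nat.card Ω) : uniformProb E ≤ 1 / a := by
  unfold uniformProb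
  rcases (Nat.cast_nonneg (α := ℝ) (Nat.card Ω)).eq_or_lt with h0 | h0
  · rw [← h0, div_zero]
    positivity
  · rw [div_le_div_iff₀ h0 ha]
    linarith

theorem uniformProb_mono [Finite Ω] {E F : Set Ω} (h : E ⊆ F) : uniformProb E ≤ uniformProb F := by
  unfold uniformProb
  gcongr
  exact Nat.card_mono F.toFinite h

theorem uniformProb_union_le (E F : Set Ω) :
    uniformProb (E ∪ F) ≤ uniformProb E + uniformProb F := by
  unfold uniformProb
  rw [← add_div]
  gcongr
  exact_mod_cast Set.ncard_union_le E F

theorem uniformProb_iUnion_le [Finite ι] (E : ι → Set Ω) {β : ℝ}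
    (h : ∀ i, uniformProb (E i) ≤ β) :
    uniformProb (⋃ i, E i) ≤ Nat.card ι * β := by
  classical
  have := Fintype.ofFinite ι
  have key : ∀ T : Finset ι, uniformProb (⋃ i ∈ T, E i) ≤ T.card * β := by
    intro T
    induction T using Finset.induction_on with
    | empty => simp [uniformProb]
    | insert i T hi ih =>
      rw [Finset.set_biUnion_insert, Finset.card_insert_of_notMem hi]
      refine (uniformProb_union_le _ _).trans ?_
      push_cast
      linarith [h i]
  simpa [Nat.card_eq_fintype_card] using key Finset.univ

/-- A bound for each value of the second coordinate is a bound for the product. -/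
theorem uniformProb_prod_le [Finite Ω] [Finite Ω'] (E : Set (Ω × Ω')) {β : ℝ} (hβ : 0 ≤ β)
    (h : ∀ y, uniformProb {x | (x, y) ∈ E} ≤ β) : uniformProb E ≤ β := by
  have := Fintype.ofFinite Ω'
  have hcard : Nat.card E = ∑ y : Ω', Nat.card {x | (x, y) ∈ E} := by
    rw [← Nat.card_sigma]
    exact Nat.card_congr ⟨fun p => ⟨p.1.2, p.1.1, p.2⟩, fun p => ⟨(p.2.1, p.1), p.2.2⟩,
      fun _ => rfl, fun _ => rfl⟩
  unfold uniformProb at h ⊢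
  refine div_le_of_le_mul₀ (by positivity) hβ ?_
  rw [hcard, Nat.card_prod, Nat.card_eq_fintype_card (α := Ω')]
  push_cast
  have : ∀ y ∈ (Finset.univ : Finset Ω'),
      (Nat.card {x | (x, y) ∈ E} : ℝ) ≤ Nat.card Ω * β := by
    intro y _
    rcases (Nat.cast_nonneg (α := ℝ) (Nat.card Ω)).eq_or_lt with h0 | h0
    · have : Nat.card {x | (x, y) ∈ E} ≤ Nat.card Ω := Finite.card_subtype_le _
      have h1 : Nat.card Ω = 0 := by exact_mod_cast h0.symm
      rw [h1, Nat.le_zero] at this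
      simp [this, h1]
    · have := (div_le_iff₀ h0).1 (h y)
      linarith
  refine (Finset.sum_le_sum this).trans (le_of_eq ?_)
  rw [Finset.sum_const, Finset.card_univ, nsmul_eq_mul]
  ring

/-- The probability that all values of a random function on a given set lie in `S`. -/
theorem uniformProb_forall_mem {Q A : Type} [Finite Q] [Finite A] [Nonempty A] (X : Finset Q)
    (S : Set A) :
    uniformProb {f : Q → A | ∀ x ∈ X, f x ∈ S} =
      ((Nat.card S : ℝ) / Nat.card A) ^ X.card := by
  classical
  have := Fintype.ofFinite Q
  have := Fintype.ofFinite A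
  have hset : {f : Q → A | ∀ x ∈ X, f x ∈ S} =
      ↑(Fintype.piFinset fun x => if x ∈ X then S.toFinset else Finset.univ) := by
    ext f
    simp only [Set.mem_ofPred_eq, Finset.mem_coe, Fintype.mem_piFinset]
    refine forall_congr' fun x => ?_
    split_ifs with hx <;> simp [hx]
  have hA : (Fintype.card A : ℝ) ≠ 0 := by exact_mod_cast Fintype.card_ne_zero
  have h1 : (∏ x : Q, (if x ∈ X then (S.toFinset.card : ℝ) else Fintype.card A)) =
      (S.toFinset.card : ℝ) ^ X.card * (Fintype.card A : ℝ) ^ (Xᶜ).card := by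
    rw [Finset.prod_ite]
    simp [Finset.filter_not, Finset.compl_eq_univ_sdiff]
  have h2 : (Fintype.card A : ℝ) ^ Fintype.card Q =
      (Fintype.card A : ℝ) ^ X.card * (Fintype.card A : ℝ) ^ (Xᶜ).card := by
    rw [← pow_add, Finset.card_add_card_compl]
  rw [uniformProb, hset, Nat.card_coe_set_eq, Set.ncard_coe_finset, Fintype.card_piFinset]
  rw [Nat.card_fun, Nat.card_eq_fintype_card, Nat.card_eq_fintype_card, Nat.card_eq_fintype_card,
    ← Set.toFinset_card]
  push_cast
  have h3 : (∏ x : Q, ((if x ∈ X then S.toFinset else Finset.univ).card : ℝ)) =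
      (S.toFinset.card : ℝ) ^ X.card * (Fintype.card A : ℝ) ^ (Xᶜ).card := by
    rw [← h1]
    refine Finset.prod_congr rfl fun x _ => ?_
    split_ifs <;> simp
  rw [h3, h2, div_pow, mul_div_mul_right _ _ (pow_ne_zero (Xᶜ).card hA)]

end UniformProb

/-! ### Extracting labels from a state -/

/-- A code for the strings of at most `M` bits: the length, and the padded string. -/
abbrev StringCode (M : ℕ) : Type := Fin (M + 1) × (Fin M → Bool)

/-- The string with a given code. -/
def StringCode.decode {M : ℕ} (p : StringCode M) : List Bool := (List.ofFn p.2).take p.1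

theorem StringCode.exists_decode_eq {M : ℕ} {l : List Bool} (h : l.length ≤ M) :
    ∃ p : StringCode M, p.decode = l := by
  refine ⟨(⟨l.length, by omega⟩, fun i => l.getD i false), ?_⟩
  refine List.ext_getElem (by simp [decode, h]) fun i h1 h2 => ?_
  simp [decode, h2]

theorem StringCode.card_le (M : ℕ) : (Nat.card (StringCode M) : ℝ) ≤ 4 ^ M := by
  rw [Nat.card_eq_fintype_card, Fintype.card_prod, Fintype.card_fin, Fintype.card_fun,
    Fintype.card_bool, Fintype.card_fin]
  have h : M + 1 ≤ 2 ^ M := Nat.lt_two_pow_self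
  have h' : (M + 1) * 2 ^ M ≤ 4 ^ M := by
    rw [show 4 = 2 * 2 by rfl, mul_pow]
    exact Nat.mul_le_mul_right _ h
  exact_mod_cast h'

namespace Dag

variable (G : Dag) {κ : ℕ} (ζ : BitVec κ) {C Y : Type}
  (B : PROMAlg ((G.V × LabelTuple κ) ⊕ BitVec κ) (BitVec κ) C Y) (ρ : C)

/-- The advice for the extraction of the label of a vertex: the vertex, the position (iteration
and index in the batch) of the first correct query for it, the position of an earlier query that
has its label as an input, and the place of the label in this input. -/
abbrev Advice (T : ℕ) : Type :=
  G.V × (Fin (T + 1) × Fin (T + 1)) × (Fin (T + 1) × Fin (T + 1)) × Fin 2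

/-- The advice `h` is correct for the execution from iteration `i` on. If the correct query is
never asked, its position is the end of the execution. -/
structure IsAdvice (O : (G.V × LabelTuple κ) ⊕ BitVec κ → BitVec κ) (x : List Bool) (i : ℕ)
    {T : ℕ} (h : G.Advice T) : Prop where
  not_asksAt : ∀ j, i ≤ j → j < h.2.1.1 → ¬ B.AsksAt O ρ x j (G.correctQuery ζ O h.1)
  getElem?_first : (B.run O ρ x h.2.1.1).halted = false →
    (B.batch h.2.1.1 ρ (B.run O ρ x h.2.1.1).state)[(h.2.1.2 : ℕ)]? =
      some (G.correctQuery ζ O h.1)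
  le_use : i ≤ h.2.2.1.1
  use_le : h.2.2.1.1 ≤ h.2.1.1
  getElem?_use : ∃ w,
    (B.batch h.2.2.1.1 ρ (B.run O ρ x h.2.2.1.1).state)[(h.2.2.1.2 : ℕ)]? =
      some (G.correctQuery ζ O w) ∧
    (G.inputTuple ζ O w).1[(h.2.2.2 : ℕ)]? = some (G.lab ζ O h.1)

variable {G ζ B ρ}

theorem exists_isAdvice {O : (G.V × LabelTuple κ) ⊕ BitVec κ → BitVec κ} {x : List Bool}
    {T i : ℕ} (hT : B.RunsWithin O ρ x T) {u : G.V} (hu : u ∈ G.pebbled ζ O B ρ x i) :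
    ∃ h : G.Advice T, h.1 = u ∧ G.IsAdvice ζ B ρ O x i h := by
  classical
  obtain ⟨j, hij, ⟨w, huw, hw⟩, hnot⟩ := hu
  obtain ⟨hjT, p, hp, hwp⟩ := hT.exists_getElem? hw
  obtain ⟨e, he⟩ := exists_getElem?_inputTuple (ζ := ζ) (O := O) huw
  by_cases hask : ∃ k, i ≤ k ∧ B.AsksAt O ρ x k (G.correctQuery ζ O u)
  · obtain ⟨hik, hk⟩ := Nat.find_spec hask
    obtain ⟨hkT, r, hr, hkr⟩ := hT.exists_getElem? hk
    refine ⟨(u, (⟨Nat.find hask, by omega⟩, ⟨r, by omega⟩), (⟨j, by omega⟩, ⟨p, by omega⟩), e),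
      rfl, fun k' h1 h2 h3 => Nat.find_min hask h2 ⟨h1, h3⟩, fun _ => hkr, hij, ?_, w, hwp, he⟩
    by_contra! hlt
    exact hnot _ hik hlt hk
  · refine ⟨(u, (⟨T, by omega⟩, 0), (⟨j, by omega⟩, ⟨p, by omega⟩), e),
      rfl, fun k' h1 _ h3 => hask ⟨k', h1, h3⟩, fun h => ?_, hij, hjT.le, w, hwp, he⟩
    exact absurd (hT.lt_of_halted_eq_false h) (lt_irrefl _)

theorem IsAdvice.lab_eq {O₁ O₂ : (G.V × LabelTuple κ) ⊕ BitVec κ → BitVec κ}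
    {x₁ x₂ : List Bool} {T i : ℕ} {h : G.Advice T} (h₁ : G.IsAdvice ζ B ρ O₁ x₁ i h)
    (h₂ : G.IsAdvice ζ B ρ O₂ x₂ i h)
    (hstate : (B.run O₁ ρ x₁ h.2.2.1.1).state = (B.run O₂ ρ x₂ h.2.2.1.1).state) :
    G.lab ζ O₁ h.1 = G.lab ζ O₂ h.1 := by
  obtain ⟨w₁, hw₁, he₁⟩ := h₁.getElem?_use
  obtain ⟨w₂, hw₂, he₂⟩ := h₂.getElem?_use
  rw [hstate, hw₂, Option.some_inj] at hw₁
  rw [(eq_of_correctQuery_eq hw₁).2, he₁] at he₂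
  exact Option.some_inj.1 he₂

/-- An oracle that is known up to the labels of some vertices, together with correct advice for
these vertices, suffices to simulate the execution from iteration `i` on, and so determines the
missing labels: each of them appears in a query before it is asked for. -/
theorem lab_eq_of_isAdvice {O₁ O₂ O : (G.V × LabelTuple κ) ⊕ BitVec κ → BitVec κ}
    {x₁ x₂ : List Bool} {T i m : ℕ} {h : Fin m → G.Advice T}
    (h₁ : ∀ l, G.IsAdvice ζ B ρ O₁ x₁ i (h l)) (h₂ : ∀ l, G.IsAdvice ζ B ρ O₂ x₂ i (h l))
    (hO₁ : ∀ q, (∀ l, q ≠ G.correctQuery ζ O₁ (h l).1) → O₁ q = O q)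
    (hO₂ : ∀ q, (∀ l, q ≠ G.correctQuery ζ O₂ (h l).1) → O₂ q = O q)
    (hstate : (B.run O₁ ρ x₁ i).state = (B.run O₂ ρ x₂ i).state)
    (hhalted : (B.run O₁ ρ x₁ i).halted = (B.run O₂ ρ x₂ i).halted) (l : Fin m) :
    G.lab ζ O₁ (h l).1 = G.lab ζ O₂ (h l).1 := by
  have hrun := PROMAlg.run_congr hstate hhalted (fun j hij hagree q hq => ?_)
  · exact (h₁ l).lab_eq (h₂ l) (hrun _ (h₁ l).le_use).1
  · have hq₂ : B.AsksAt O₂ ρ x₂ j q := by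
      obtain ⟨e1, e2⟩ := hagree j hij le_rfl
      exact ⟨e2 ▸ hq.1, e1 ▸ hq.2⟩
    -- once the correct query of a vertex may be asked, it is known, and so is the label
    have key : ∀ l, (h l).2.1.1 ≤ j →
        G.correctQuery ζ O₁ (h l).1 = G.correctQuery ζ O₂ (h l).1 ∧
          G.lab ζ O₁ (h l).1 = G.lab ζ O₂ (h l).1 := by
      intro l hl
      have hle := (h₁ l).use_le
      have hle' := (h₁ l).le_use
      constructor
      · have e₁ := (h₁ l).getElem?_first (PROMAlg.halted_eq_false_of_le hl hq.1)
        have e₂ := (h₂ l).getElem?_first (PROMAlg.halted_eq_false_of_le hl hq₂.1)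
        rw [(hagree _ (by omega) hl).1, e₂, Option.some_inj] at e₁
        exact e₁.symm
      · exact (h₁ l).lab_eq (h₂ l) (hagree _ hle' (by omega)).1
    by_cases hq' : ∃ l, q = G.correctQuery ζ O₁ (h l).1 ∨ q = G.correctQuery ζ O₂ (h l).1
    · obtain ⟨l, hl⟩ := hq'
      have hj : (h l).2.1.1 ≤ j := by
        by_contra! hlt
        rcases hl with rfl | rfl
        · exact (h₁ l).not_asksAt j hij hlt hq
        · exact (h₂ l).not_asksAt j hij hlt hq₂
      obtain ⟨e1, e2⟩ := key l hj
      have hl₁ : q = G.correctQuery ζ O₁ (h l).1 := hl.elim id fun hl => hl.trans e1.symm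
      rw [hl₁, ← G.lab_eq ζ O₁, e2, e1, ← G.lab_eq ζ O₂]
    · push Not at hq'
      rw [hO₁ q fun l => (hq' l).1, hO₂ q fun l => (hq' l).2]

variable (G ζ B ρ)

/-- It is unlikely that a short state corresponds to many pebbles. The union bound runs over the
contents of the state and over the advice. -/
theorem uniformProb_pebbled_le
    (x : ((G.V × LabelTuple κ) ⊕ BitVec κ → BitVec κ) → List Bool) (T M m i : ℕ)
    (hT : ∀ O, B.RunsWithin O ρ (x O) T) :
    uniformProb {O | (B.run O ρ (x O) i).halted = false ∧
        (B.run O ρ (x O) i).state.length ≤ M ∧ m ≤ (G.pebbled ζ O B ρ (x O) i).ncard} ≤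
      4 ^ M * (Nat.card G.V * (2 * (T + 1) ^ 4) / 2 ^ κ : ℝ) ^ m := by
  let E : StringCode M × (Fin m → G.Advice T) →
      Set ((G.V × LabelTuple κ) ⊕ BitVec κ → BitVec κ) := fun p =>
    {O | (B.run O ρ (x O) i).halted = false ∧ (B.run O ρ (x O) i).state = p.1.decode ∧
      Function.Injective (fun l => (p.2 l).1) ∧ ∀ l, G.IsAdvice ζ B ρ O (x O) i (p.2 l)}
  have hE : ∀ p, uniformProb (E p) ≤ 1 / ((2 ^ κ) ^ m : ℝ) := by
    intro p
    by_cases hinj : Function.Injective (fun l => (p.2 l).1)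
    · refine uniformProb_le_of_card_mul_le (by positivity) ?_
      have := G.card_mul_le_of_lab_eq ζ hinj (E p) (fun O₁ h₁ O₂ h₂ O hO₁ hO₂ l =>
        lab_eq_of_isAdvice h₁.2.2.2 h₂.2.2.2 hO₁ hO₂ (h₁.2.1.trans h₂.2.1.symm)
          (h₁.1.trans h₂.1.symm) l)
      exact_mod_cast this
    · have : E p = ∅ := Set.eq_empty_of_forall_notMem fun O hO => hinj hO.2.2.1
      rw [this]
      simp only [uniformProb, Nat.card_of_isEmpty, Nat.cast_zero, zero_div]
      positivity
  refine (uniformProb_mono (F := ⋃ p, E p) ?_).trans ((uniformProb_iUnion_le E hE).trans ?_)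
  · rintro O ⟨hhalted, hlen, hm⟩
    obtain ⟨p, hp⟩ := StringCode.exists_decode_eq hlen
    obtain ⟨K, hK, hcard⟩ := Set.exists_subset_card_eq hm
    let g : Fin m ≃ K := (Finite.equivFinOfCardEq (by rwa [Nat.card_coe_set_eq])).symm
    choose a ha₁ ha₂ using fun l => exists_isAdvice (hT O) (hK (g l).2)
    refine Set.mem_iUnion.2 ⟨(p, a), hhalted, hp.symm, ?_, ha₂⟩
    intro l l' h
    simp only [ha₁] at h
    exact g.injective (Subtype.ext h)
  · rw [Nat.card_prod, Nat.card_fun]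
    have hM := StringCode.card_le M
    generalize Nat.card (StringCode M) = N at hM ⊢
    simp only [Nat.card_prod, Nat.card_eq_fintype_card (α := Fin _), Fintype.card_fin]
    push_cast
    rw [div_pow, mul_assoc]
    refine mul_le_mul hM (le_of_eq ?_) (by positivity) (by positivity)
    rw [mul_one_div]
    congr 2
    ring

/-- It is unlikely that an algorithm with a short input outputs the labels of many vertices that
it has not asked for. -/
theorem uniformProb_outputs_le {s : ℕ} (tgt : Fin s → G.V) (htgt : Function.Injective tgt)
    (idx : BitVec κ → Fin s) (X : Finset (BitVec κ))
    (B : PROMAlg ((G.V × LabelTuple κ) ⊕ BitVec κ) (BitVec κ) C (BitVec κ × BitVec κ))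
    (x : ((G.V × LabelTuple κ) ⊕ BitVec κ → BitVec κ) → List Bool) (M m : ℕ)
    (hx : ∀ O, (x O).length ≤ M) :
    uniformProb {O | B.Outputs O ρ (x O) {y | y.1 ∈ X ∧
          y.2 = G.lab ζ O (tgt (idx (O (Sum.inr y.1)))) ^^^ O (Sum.inr (y.1 + 1))} ∧
        m ≤ {k | (∃ a ∈ X, idx (O (Sum.inr a)) = k) ∧
          ∀ t, tgt k ∉ G.asked ζ O B ρ (x O) t}.ncard} ≤
      4 ^ M * (s / 2 ^ κ : ℝ) ^ m := by
  let E : StringCode M × (Fin m → Fin s) →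
      Set ((G.V × LabelTuple κ) ⊕ BitVec κ → BitVec κ) := fun p =>
    {O | x O = p.1.decode ∧ Function.Injective p.2 ∧
      (∀ l, ∃ a ∈ X, idx (O (Sum.inr a)) = p.2 l) ∧
      (∀ l t, tgt (p.2 l) ∉ G.asked ζ O B ρ (x O) t) ∧
      B.Outputs O ρ (x O) {y | y.1 ∈ X ∧
        y.2 = G.lab ζ O (tgt (idx (O (Sum.inr y.1)))) ^^^ O (Sum.inr (y.1 + 1))}}
  have hE : ∀ p, uniformProb (E p) ≤ 1 / ((2 ^ κ) ^ m : ℝ) := by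
    intro p
    by_cases hinj : Function.Injective p.2
    · refine uniformProb_le_of_card_mul_le (by positivity) ?_
      have := G.card_mul_le_of_lab_eq ζ (htgt.comp hinj) (E p) ?_
      · exact_mod_cast this
      rintro O₁ ⟨hx₁, -, hhit, hask₁, hout₁⟩ O₂ ⟨hx₂, -, -, hask₂, hout₂⟩ O hO₁ hO₂ l
      have hrun := fun j => PROMAlg.run_congr (B := B) (O₁ := O₁) (O₂ := O₂) (ρ := ρ)
        (x₁ := x O₁) (x₂ := x O₂) (i := 0) (hx₁.trans hx₂.symm) rfl (fun j _ hagree q hq => by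
          have hq₂ : B.AsksAt O₂ ρ (x O₂) j q := by
            obtain ⟨e1, e2⟩ := hagree j (Nat.zero_le j) le_rfl
            exact ⟨e2 ▸ hq.1, e1 ▸ hq.2⟩
          rw [hO₁ q fun l hl => hask₁ l j (by subst hl; exact hq),
            hO₂ q fun l hl => hask₂ l j (by subst hl; exact hq₂)])
        j (Nat.zero_le j)
      have hinr : ∀ a, O₁ (Sum.inr a) = O₂ (Sum.inr a) := fun a => by
        rw [hO₁ _ (by simp [correctQuery]), hO₂ _ (by simp [correctQuery])]
      obtain ⟨i₁, hi₁⟩ := hout₁.of_le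
      obtain ⟨i₂, hi₂⟩ := hout₂.of_le
      have hset := (hi₁ (max i₁ i₂) (le_max_left _ _)).symm.trans
        ((congrArg (fun L => {y | y ∈ L}) ((hrun (max i₁ i₂)).2.2 rfl)).trans
          (hi₂ (max i₁ i₂) (le_max_right _ _)))
      obtain ⟨a, ha, hal⟩ := hhit l
      have hmem : (a, G.lab ζ O₁ (tgt (idx (O₁ (Sum.inr a)))) ^^^ O₁ (Sum.inr (a + 1))) ∈
          {y : BitVec κ × BitVec κ | y.1 ∈ X ∧
            y.2 = G.lab ζ O₂ (tgt (idx (O₂ (Sum.inr y.1)))) ^^^ O₂ (Sum.inr (y.1 + 1))} :=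
        hset ▸ ⟨ha, rfl⟩
      have heq := hmem.2
      simp only [← hinr, hal] at heq
      exact BitVec.xor_left_inj _ |>.1 heq
    · have : E p = ∅ := Set.eq_empty_of_forall_notMem fun O hO => hinj hO.2.1
      rw [this]
      simp only [uniformProb, Nat.card_of_isEmpty, Nat.cast_zero, zero_div]
      positivity
  refine (uniformProb_mono (F := ⋃ p, E p) ?_).trans ((uniformProb_iUnion_le E hE).trans ?_)
  · rintro O ⟨hout, hm⟩
    obtain ⟨p, hp⟩ := StringCode.exists_decode_eq (hx O)
    obtain ⟨K, hK, hcard⟩ := Set.exists_subset_card_eq hm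
    let g : Fin m ≃ K := (Finite.equivFinOfCardEq (by rwa [Nat.card_coe_set_eq])).symm
    exact Set.mem_iUnion.2 ⟨(p, fun l => g l), hp.symm,
      fun l l' h => g.injective (Subtype.ext h), fun l => (hK (g l).2).1,
      fun l => (hK (g l).2).2, hout⟩
  · rw [Nat.card_prod, Nat.card_fun]
    have hM := StringCode.card_le M
    generalize Nat.card (StringCode M) = N at hM ⊢
    simp only [Nat.card_eq_fintype_card (α := Fin _), Fintype.card_fin]
    push_cast
    rw [div_pow, mul_assoc]
    refine mul_le_mul hM (le_of_eq ?_) (by positivity) (by positivity)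
    rw [mul_one_div]

end Dag

/-! ### The indices that are looked up -/

theorem card_toNat_mod_mem_le {κ s : ℕ} (J : Finset ℕ) :
    Nat.card {a : BitVec κ | a.toNat % s ∈ J} ≤ J.card * (2 ^ κ / s + 1) := by
  have := Nat.card_le_card_of_injective
    (fun a : {a : BitVec κ | a.toNat % s ∈ J} =>
      ((⟨a.1.toNat % s, a.2⟩, ⟨a.1.toNat / s, by
        have := a.1.isLt
        exact Nat.lt_succ_of_le (Nat.div_le_div_right this.le)⟩) : J × Fin (2 ^ κ / s + 1))) (by
      rintro ⟨a, ha⟩ ⟨b, hb⟩ h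
      simp only [Prod.mk.injEq, Subtype.mk.injEq, Fin.mk.injEq] at h
      refine Subtype.ext (BitVec.eq_of_toNat_eq ?_)
      simp only
      rw [← Nat.div_add_mod a.toNat s, ← Nat.div_add_mod b.toNat s, h.1, h.2])
  simpa [Nat.card_prod, Nat.card_eq_fintype_card] using this

/-- It is unlikely that a large set of inputs looks up only few of the `s` words. -/
theorem uniformProb_card_image_le {Q : Type} [Finite Q] {κ s : ℕ} (hs : 0 < s)
    (hκ : 4 * s ≤ 2 ^ κ) (X : Finset Q) (hX : 4 * s ≤ X.card) :
    uniformProb {O : Q → BitVec κ | (X.image fun a => (O a).toNat % s).card ≤ s / 2} ≤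
      (2 / 3 : ℝ) ^ s := by
  classical
  let E : Finset (Fin s) → Set (Q → BitVec κ) := fun J =>
    {O | J.card ≤ s / 2 ∧ ∀ a ∈ X, O a ∈ {b : BitVec κ | b.toNat % s ∈ J.image Fin.val}}
  have hE : ∀ J, uniformProb (E J) ≤ (3 / 4 : ℝ) ^ (4 * s) := by
    intro J
    by_cases hJ : J.card ≤ s / 2
    · have : E J =
          {O | ∀ a ∈ X, O a ∈ {b : BitVec κ | b.toNat % s ∈ J.image Fin.val}} := by
        ext O
        exact and_iff_right hJ
      rw [this, uniformProb_forall_mem, natCard_bitVec]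
      have h1 := card_toNat_mod_mem_le (κ := κ) (s := s) (J.image Fin.val)
      have h2 : (J.image Fin.val).card ≤ s / 2 := Finset.card_image_le.trans hJ
      have h3 : 4 * Nat.card {b : BitVec κ | b.toNat % s ∈ J.image Fin.val} ≤ 3 * 2 ^ κ := by
        have h4 := h1.trans (Nat.mul_le_mul_right _ h2)
        have h5 : s / 2 * (2 ^ κ / s + 1) = s / 2 * (2 ^ κ / s) + s / 2 := by ring
        have h6 : 2 * (s / 2 * (2 ^ κ / s)) ≤ 2 ^ κ := by
          rw [← mul_assoc]
          exact (Nat.mul_le_mul_right _ (by omega)).trans (Nat.mul_div_le (2 ^ κ) s)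
        omega
      have h7 : (Nat.card {b : BitVec κ | b.toNat % s ∈ J.image Fin.val} : ℝ) /
          ((2 ^ κ : ℕ) : ℝ) ≤ 3 / 4 := by
        rw [div_le_div_iff₀ (by positivity) (by norm_num)]
        have : (4 * Nat.card {b : BitVec κ | b.toNat % s ∈ J.image Fin.val} : ℝ) ≤
          3 * (2 ^ κ : ℕ) := by exact_mod_cast h3
        linarith
      refine (pow_le_pow_left₀ (by positivity) h7 _).trans ?_
      exact pow_le_pow_of_le_one (by norm_num) (by norm_num) hX
    · have : E J = ∅ := Set.eq_empty_of_forall_notMem fun O hO => hJ hO.1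
      rw [this]
      simp only [uniformProb, Nat.card_of_isEmpty, Nat.cast_zero, zero_div]
      positivity
  refine (uniformProb_mono (F := ⋃ J, E J) ?_).trans ((uniformProb_iUnion_le E hE).trans ?_)
  · intro O hO
    refine Set.mem_iUnion.2 ⟨X.image fun a => ⟨(O a).toNat % s, Nat.mod_lt _ hs⟩, ?_, ?_⟩
    · rw [← Finset.card_image_of_injective _ Fin.val_injective, Finset.image_image]
      exact hO
    · intro a ha
      simp only [Set.mem_ofPred_eq, Finset.image_image, Finset.mem_image]
      exact ⟨a, ha, rfl⟩
  · rw [Nat.card_eq_fintype_card, Fintype.card_finset, Fintype.card_fin, pow_mul]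
    push_cast
    rw [← mul_pow]
    gcongr
    norm_num

/-! ### The success probability for one security parameter -/

/-- The index that the hash function looks up when the first answer is `a`. -/
def lookupIndex {κ : ℕ} (s : ℕ) (hs : 2 ≤ s) (a : BitVec κ) : Fin s :=
  ⟨a.toNat % s, Nat.mod_lt _ (by omega)⟩

section Layered

variable {s c : ℕ} {hs : 2 ≤ s} {hc : 2 ≤ c} {root : ∀ i : Fin s, Fin (s - i)}

theorem layeredTarget_injective : Function.Injective (layeredTarget s c hs hc root) :=
  fun _ _ h => Fin.ext (congrArg (fun x => x.1.2) h)

variable {κ : ℕ} (ζ : BitVec κ) {C : Type}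

/-- In an execution without short states that correspond to many pebbles, and with long states
in few iterations only, most targets are not asked for. -/
theorem ncard_asked_targets_le {Y : Type}
    (B : PROMAlg (((layeredGraph s c hs hc root).V × LabelTuple κ) ⊕ BitVec κ) (BitVec κ) C Y)
    (ρ : C) (O : ((layeredGraph s c hs hc root).V × LabelTuple κ) ⊕ BitVec κ → BitVec κ)
    (x : List Bool) {T M : ℕ} (hT : B.RunsWithin O ρ x T) (hs' : 1000 ≤ s) (hx : x.length ≤ M)
    (hgood : ∀ i < T, ¬ ((B.run O ρ x i).halted = false ∧ (B.run O ρ x i).state.length ≤ M ∧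
      s / 64 + 1 ≤ ((layeredGraph s c hs hc root).pebbled ζ O B ρ x i).ncard))
    (hmem : B.sustainedMem O ρ x M < BaseVertex.depth s) :
    {k : Fin s | ∃ t, layeredTarget s c hs hc root k ∈
      (layeredGraph s c hs hc root).asked ζ O B ρ x t}.ncard ≤ s / 64 := by
  have hgood' : ∀ i, (B.run O ρ x i).halted = false → (B.run O ρ x i).state.length ≤ M →
      ((layeredGraph s c hs hc root).pebbled ζ O B ρ x i).ncard ≤ s / 64 := by
    intro i h1 h2
    by_contra! h3
    exact hgood i (hT.lt_of_halted_eq_false h1) ⟨h1, h2, h3⟩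
  refine ncard_targets_le (Dag.isPebbling_pebbled _ ζ O B ρ x) hs' (hgood' 0 rfl hx) ?_
  refine (Set.encard_le_encard fun i hi => ?_).trans_lt hmem
  have hhalted : (B.run O ρ x i).halted = false := by
    by_contra hh
    rw [Bool.not_eq_false] at hh
    have hi : s / 64 < _ := hi
    rw [Dag.pebbled_eq_empty_of_halted _ _ _ _ _ _ hh, Set.ncard_empty] at hi
    omega
  refine ⟨hhalted, ?_⟩
  by_contra! hlt
  exact absurd (hgood' i hhalted hlt.le) (not_le.2 hi)

/-- The three terms bound the probabilities that some short state corresponds to many pebbles,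
that many labels are output without being asked for, and that few words are looked up. -/
theorem uniformProb_layered_le [Finite C]
    (B : PROMAlg (((layeredGraph s c hs hc root).V × LabelTuple κ) ⊕ BitVec κ) (BitVec κ) C
      (BitVec κ × BitVec κ))
    (x : (((layeredGraph s c hs hc root).V × LabelTuple κ) ⊕ BitVec κ → BitVec κ) → List Bool)
    {T M : ℕ} (hT : ∀ O ρ, B.RunsWithin O ρ (x O) T) (hs' : 1000 ≤ s)
    (hx : ∀ O, (x O).length ≤ M) (X : Finset (BitVec κ)) (hX : 4 * s ≤ X.card)
    (hκ : 4 * s ≤ 2 ^ κ) :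
    uniformProb {ω : (((layeredGraph s c hs hc root).V × LabelTuple κ) ⊕ BitVec κ →
        BitVec κ) × C |
      B.Outputs ω.1 ω.2 (x ω.1) {y | y.1 ∈ X ∧
        y.2 = (layeredGraph s c hs hc root).lab ζ ω.1
          (layeredTarget s c hs hc root (lookupIndex s hs (ω.1 (Sum.inr y.1)))) ^^^
            ω.1 (Sum.inr (y.1 + 1))} ∧
      B.sustainedMem ω.1 ω.2 (x ω.1) M < BaseVertex.depth s} ≤
    T * (4 ^ M * (Nat.card (layeredGraph s c hs hc root).V * (2 * (T + 1) ^ 4) / 2 ^ κ : ℝ) ^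
      (s / 64 + 1)) + 4 ^ M * (s / 2 ^ κ : ℝ) ^ (s / 4) + (2 / 3 : ℝ) ^ s := by
  classical
  refine uniformProb_prod_le _ (by positivity) fun ρ => ?_
  have hbad := uniformProb_iUnion_le _ fun i : Fin T =>
    (layeredGraph s c hs hc root).uniformProb_pebbled_le ζ B ρ x T M (s / 64 + 1) i
      fun O => hT O ρ
  rw [Nat.card_eq_fintype_card, Fintype.card_fin] at hbad
  have hout := (layeredGraph s c hs hc root).uniformProb_outputs_le ζ ρ
    (layeredTarget s c hs hc root) layeredTarget_injective (lookupIndex s hs) X B x M (s / 4) hx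
  have himage := uniformProb_card_image_le
    (Q := ((layeredGraph s c hs hc root).V × LabelTuple κ) ⊕ BitVec κ) (κ := κ)
    (show 0 < s by omega) hκ (X.map ⟨Sum.inr, Sum.inr_injective⟩) (by rwa [Finset.card_map])
  refine (uniformProb_mono ?_).trans ((uniformProb_union_le _ _).trans
    (add_le_add ((uniformProb_union_le _ _).trans (add_le_add hbad hout)) himage))
  rintro O ⟨hO, hmem⟩
  by_contra hcon
  simp only [Set.mem_union, not_or] at hcon
  obtain ⟨⟨h1, h2⟩, h3⟩ := hcon
  refine h2 ⟨hO, ?_⟩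
  have hasked := ncard_asked_targets_le ζ B ρ O (x O) (hT O ρ) hs' (hx O)
    (fun i hi h => h1 (Set.mem_iUnion.2 ⟨⟨i, hi⟩, h⟩)) hmem
  -- more than half of the indices are looked up, and few targets are asked for
  have hhit : s / 2 < {k : Fin s | ∃ a ∈ X, lookupIndex s hs (O (Sum.inr a)) = k}.ncard := by
    have h3 : s / 2 < _ := not_le.1 h3
    have heq : {k : Fin s | ∃ a ∈ X, lookupIndex s hs (O (Sum.inr a)) = k} =
        ↑(X.image fun a => lookupIndex s hs (O (Sum.inr a))) := by
      ext k
      simp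
    rw [heq, Set.ncard_coe_finset, ← Finset.card_image_of_injective _ Fin.val_injective,
      Finset.image_image]
    rw [Finset.map_eq_image, Finset.image_image] at h3
    exact h3
  have hsub := Set.le_ncard_sdiff
    {k : Fin s | ∃ t, layeredTarget s c hs hc root k ∈
      (layeredGraph s c hs hc root).asked ζ O B ρ (x O) t}
    {k : Fin s | ∃ a ∈ X, lookupIndex s hs (O (Sum.inr a)) = k}
  have hle : s / 4 ≤ ({k : Fin s | ∃ a ∈ X, lookupIndex s hs (O (Sum.inr a)) = k} \
      {k : Fin s | ∃ t, layeredTarget s c hs hc root k ∈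
        (layeredGraph s c hs hc root).asked ζ O B ρ (x O) t}).ncard := by omega
  refine hle.trans (Set.ncard_le_ncard ?_ (Set.toFinite _))
  rintro k ⟨hk1, hk2⟩
  exact ⟨hk1, fun t ht => hk2 ⟨t, ht⟩⟩

/-- The saving of `κ / 2` bits for each of the extracted labels outweighs the `2 M` bits that
encode a string of length at most `M`. -/
theorem four_pow_mul_pow_le {κ s M m A : ℕ} (hA : A ^ 2 ≤ 2 ^ κ) (hs' : 1000 ≤ s)
    (hM : 512 * M ≤ κ * s) (hm : 2 * (s / 128) ≤ m) :
    (4 : ℝ) ^ M * (A / 2 ^ κ : ℝ) ^ m ≤ (1 / 2) ^ κ := by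
  have hsq : (A / 2 ^ κ : ℝ) ^ 2 ≤ (1 / 2) ^ κ := by
    have : (A : ℝ) ^ 2 ≤ 2 ^ κ := by exact_mod_cast hA
    rw [div_pow, one_div, inv_pow, div_le_iff₀ (by positivity), pow_two (2 ^ κ : ℝ), ← mul_assoc,
      inv_mul_cancel₀ (by positivity), one_mul]
    exact this
  have hle1 : (A / 2 ^ κ : ℝ) ≤ 1 := by
    refine (sq_le_one_iff₀ (by positivity)).1 (hsq.trans ?_)
    exact pow_le_one₀ (by norm_num) (by norm_num)
  have hexp : 2 * M + κ ≤ κ * (s / 128) := by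
    obtain ⟨d, hd⟩ : ∃ d, s < 128 * d + 128 ∧ d = s / 128 := ⟨s / 128, by omega, rfl⟩
    have h7 : 7 ≤ d := by omega
    rw [← hd.2]
    have h1 : κ * s ≤ κ * (128 * d + 128) := Nat.mul_le_mul_left _ hd.1.le
    have h2 : κ * 7 ≤ κ * d := Nat.mul_le_mul_left _ h7
    have h3 : κ * (128 * d + 128) = 128 * (κ * d) + 128 * κ := by ring
    omega
  calc (4 : ℝ) ^ M * (A / 2 ^ κ : ℝ) ^ m
      ≤ 4 ^ M * (A / 2 ^ κ : ℝ) ^ (2 * (s / 128)) := by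
        gcongr ?_ * ?_
        exact pow_le_pow_of_le_one (by positivity) hle1 hm
    _ ≤ 4 ^ M * ((1 / 2) ^ κ) ^ (s / 128) := by
        rw [pow_mul]
        gcongr
    _ = 2 ^ (2 * M) * (1 / 2) ^ (κ * (s / 128)) := by
        rw [pow_mul, ← pow_mul]
        norm_num
    _ ≤ 2 ^ (2 * M) * (1 / 2) ^ (2 * M + κ) := by
        gcongr ?_ * ?_
        exact pow_le_pow_of_le_one (by norm_num) (by norm_num) hexp
    _ = (1 / 2) ^ κ := by
        rw [pow_add, ← mul_assoc, ← mul_pow]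
        norm_num

theorem uniformProb_layered_le_of_le [Finite C]
    (B : PROMAlg (((layeredGraph s c hs hc root).V × LabelTuple κ) ⊕ BitVec κ) (BitVec κ) C
      (BitVec κ × BitVec κ))
    (x : (((layeredGraph s c hs hc root).V × LabelTuple κ) ⊕ BitVec κ → BitVec κ) → List Bool)
    {T M : ℕ} (hT : ∀ O ρ, B.RunsWithin O ρ (x O) T) (hs' : 1000 ≤ s)
    (hx : ∀ O, (x O).length ≤ M) (X : Finset (BitVec κ)) (hX : 4 * s ≤ X.card)
    (hA : ((c + 9) * s ^ 2 * (2 * (T + 1) ^ 4)) ^ 2 ≤ 2 ^ κ) (hM : 512 * M ≤ κ * s) :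
    uniformProb {ω : (((layeredGraph s c hs hc root).V × LabelTuple κ) ⊕ BitVec κ →
        BitVec κ) × C |
      B.Outputs ω.1 ω.2 (x ω.1) {y | y.1 ∈ X ∧
        y.2 = (layeredGraph s c hs hc root).lab ζ ω.1
          (layeredTarget s c hs hc root (lookupIndex s hs (ω.1 (Sum.inr y.1)))) ^^^
            ω.1 (Sum.inr (y.1 + 1))} ∧
      B.sustainedMem ω.1 ω.2 (x ω.1) M < BaseVertex.depth s} ≤
    (T + 1) * (1 / 2) ^ κ + (2 / 3 : ℝ) ^ s := by
  have hT1 : 1 ≤ (T + 1) ^ 4 := Nat.one_le_pow _ _ (by omega)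
  have hsA : 4 * s ≤ (c + 9) * s ^ 2 * (2 * (T + 1) ^ 4) := by
    calc 4 * s ≤ 9 * s ^ 2 * (2 * 1) := by nlinarith
      _ ≤ _ := by gcongr; omega
  have hκ : 4 * s ≤ 2 ^ κ := hsA.trans ((Nat.le_self_pow (by norm_num) _).trans hA)
  refine (uniformProb_layered_le ζ B x hT hs' hx X hX hκ).trans ?_
  have h1 := four_pow_mul_pow_le (A := Nat.card (layeredGraph s c hs hc root).V *
      (2 * (T + 1) ^ 4)) (m := s / 64 + 1)
    (le_trans (by gcongr; exact card_layeredGraph_le) hA) hs' hM (by omega)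
  have h2 := four_pow_mul_pow_le (A := s) (m := s / 4)
    (le_trans (Nat.pow_le_pow_left (by omega) 2) hA) hs' hM (by omega)
  push_cast at h1
  have h3 := mul_le_mul_of_nonneg_left h1 (Nat.cast_nonneg (α := ℝ) T)
  linarith

end Layered

/-! ### Asymptotics -/

theorem superpolynomialDecay_half_pow :
    SuperpolynomialDecay atTop (fun κ : ℕ => (κ : ℝ)) (fun κ => (1 / 2 : ℝ) ^ κ) := fun k =>
  tendsto_pow_const_mul_const_pow_of_abs_lt_one k (by rw [abs_of_pos] <;> norm_num)

theorem superpolynomialDecay_eval_mul_half_pow (p : Polynomial ℕ) :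
    SuperpolynomialDecay atTop (fun κ : ℕ => (κ : ℝ))
      (fun κ => ((p.eval κ : ℕ) : ℝ) * (1 / 2 : ℝ) ^ κ) := by
  refine (superpolynomialDecay_half_pow.polynomial_mul (p.map (Nat.castRingHom ℝ))).congr ?_
  intro κ
  rw [Polynomial.eval_natCast_map]
  rfl

theorem eventually_eval_le_two_pow (p : Polynomial ℕ) : ∀ᶠ κ : ℕ in atTop, p.eval κ ≤ 2 ^ κ := by
  have h := superpolynomialDecay_eval_mul_half_pow p 0
  simp only [pow_zero, one_mul] at h
  filter_upwards [h.eventually_le_const one_pos] with κ hκ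
  rw [one_div, inv_pow, ← div_eq_mul_inv, div_le_one (by positivity)] at hκ
  exact_mod_cast hκ

theorem superpolynomialDecay_exp_neg_mul {Δ : ℕ → ℕ}
    (hΔ : (fun κ : ℕ => Real.log κ) =o[atTop] (fun κ => (Δ κ : ℝ))) {a : ℝ} (ha : 0 < a) :
    SuperpolynomialDecay atTop (fun κ : ℕ => (κ : ℝ)) (fun κ => Real.exp (-(a * Δ κ))) := by
  intro k
  refine squeeze_zero' (Eventually.of_forall fun κ => by positivity) ?_
    tendsto_inv_atTop_nhds_zero_nat
  filter_upwards [hΔ.def (c := a / (k + 1)) (by positivity), eventually_ge_atTop 1] with κ h h1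
  have h0 : (0 : ℝ) < κ := by exact_mod_cast h1
  rw [Real.norm_of_nonneg (Real.log_natCast_nonneg κ), Real.norm_of_nonneg (by positivity),
    div_mul_eq_mul_div, le_div_iff₀ (by positivity)] at h
  calc (κ : ℝ) ^ k * Real.exp (-(a * Δ κ))
      = Real.exp (k * Real.log κ - a * Δ κ) := by
        rw [sub_eq_add_neg, Real.exp_add, mul_comm (k : ℝ), Real.exp_mul, Real.exp_log h0,
          Real.rpow_natCast]
    _ ≤ Real.exp (-Real.log κ) := by
        refine Real.exp_le_exp.2 ?_
        linarith
    _ = (κ : ℝ)⁻¹ := by rw [Real.exp_neg, Real.exp_log h0]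

theorem tendsto_atTop_of_log_isLittleO {Δ : ℕ → ℕ}
    (hΔ : (fun κ : ℕ => Real.log κ) =o[atTop] (fun κ => (Δ κ : ℝ))) :
    Tendsto (fun κ => (Δ κ : ℝ)) atTop atTop := by
  refine tendsto_atTop_mono' atTop ?_
    (Real.tendsto_log_atTop.comp tendsto_natCast_atTop_atTop)
  filter_upwards [hΔ.def one_pos] with κ h
  rw [Real.norm_of_nonneg (Real.log_natCast_nonneg κ), Real.norm_of_nonneg (by positivity),
    one_mul] at h
  exact h

section Hash

variable {c : ℕ} {hc : 2 ≤ c} {s : ℕ → ℕ} {hs : ∀ κ, 2 ≤ s κ}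
  {root : ∀ κ, ∀ i : Fin (s κ), Fin (s κ - i)} {ζ : ∀ κ, BitVec κ}

theorem layeredSHF_hash (κ : ℕ)
    (O : (layeredSHF c hc s hs root ζ).Query κ → BitVec κ)
    (x : BitVec κ) :
    (layeredSHF c hc s hs root ζ).hash κ O x =
      (layeredGraph (s κ) c (hs κ) hc (root κ)).lab (ζ κ) O
        (layeredTarget (s κ) c (hs κ) hc (root κ)
          (lookupIndex (s κ) (hs κ) (O (Sum.inr x)))) ^^^ O (Sum.inr (x + 1)) := by
  have hlt := Nat.mod_lt (O (Sum.inr x)).toNat (show 0 < s κ by have := hs κ; omega)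
  simp only [SHF.hash, layeredSHF, graphSHF, List.length_map, List.length_ofFn]
  congr 1
  rw [List.getD_eq_getElem _ _ (by simpa using hlt)]
  simp [Dag.lab, lookupIndex]

/-- Hardness, provided that the memory is small compared with the static string and that the
number of inputs is large compared with the number of words. -/
theorem layeredSHF_isHard (hpoly : ∃ p : Polynomial ℕ, ∀ κ, s κ ≤ p.eval κ) {u Λ q : ℕ → ℕ}
    {K : ℝ} (hK : 0 < K) (hΛ : ∀ᶠ κ in atTop, (Λ κ : ℝ) ≤ K * s κ)
    (hu : ∀ᶠ κ in atTop, 512 * (u κ * Λ κ) ≤ κ * s κ)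
    (hq : ∀ᶠ κ in atTop, 3 ≤ Λ κ → 4 * s κ ≤ q κ) :
    (layeredSHF c hc s hs root ζ).IsHard u Λ (fun κ => BaseVertex.depth (s κ)) q := by
  intro Δ hΔ R hR r B hB X
  obtain ⟨p, hp⟩ := hB
  obtain ⟨p', hp'⟩ := hpoly
  set a : ℝ := Real.log (3 / 2) / K with ha_def
  have ha : 0 < a := div_pos (Real.log_pos (by norm_num)) hK
  -- the additional power of `1 / 2` makes the inequality strict
  refine ⟨fun κ => (((p + 1).eval κ : ℕ) : ℝ) * (1 / 2) ^ κ + Real.exp (-(a * Δ κ)) +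
    (1 / 2) ^ κ, ((superpolynomialDecay_eval_mul_half_pow (p + 1)).add
      (superpolynomialDecay_exp_neg_mul hΔ ha)).add superpolynomialDecay_half_pow, ?_⟩
  have hΔ' := tendsto_atTop_of_log_isLittleO hΔ
  filter_upwards [hΛ, hu, hq, hΔ'.eventually_ge_atTop 3,
    hΔ'.eventually_ge_atTop (1000 * K),
    eventually_eval_le_two_pow ((((c + 9 : ℕ) : Polynomial ℕ) * p' ^ 2 * (2 * (p + 1) ^ 4)) ^ 2)]
    with κ hΛ hu hq hΔ3 hΔK hA hle hX
  have hle' : (Δ κ : ℝ) ≤ Λ κ := by exact_mod_cast hle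
  have hs' : 1000 ≤ s κ := by
    have : 1000 * K ≤ s κ * K := by linarith
    exact_mod_cast le_of_mul_le_mul_right this hK
  have hΛ3 : 3 ≤ Λ κ := by
    have : (3 : ℝ) ≤ Λ κ := hΔ3.trans hle'
    exact_mod_cast this
  have hA' : ((c + 9) * s κ ^ 2 * (2 * (p.eval κ + 1) ^ 4)) ^ 2 ≤ 2 ^ κ := by
    refine le_trans ?_ hA
    simp only [Polynomial.eval_pow, Polynomial.eval_mul, Polynomial.eval_natCast,
      Polynomial.eval_add, Polynomial.eval_one, Polynomial.eval_ofNat, Nat.cast_id]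
    gcongr
    exact hp' κ
  have hprob := uniformProb_layered_le_of_le (ζ κ) (B κ) (R κ) (hp κ) hs'
    (M := u κ * Λ κ) (fun O => (hR κ O).trans_le (Nat.mul_le_mul_left _ (Nat.sub_le _ _)))
    (X κ) (by rw [hX]; exact hq hΛ3) hA' hu
  have hexp : (2 / 3 : ℝ) ^ s κ ≤ Real.exp (-(a * Δ κ)) := by
    have h23 : (2 / 3 : ℝ) = Real.exp (-Real.log (3 / 2)) := by
      rw [Real.exp_neg, Real.exp_log (by norm_num)]
      norm_num
    rw [h23, ← Real.exp_nat_mul]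
    refine Real.exp_le_exp.2 ?_
    have : a * Δ κ ≤ a * (K * s κ) := by gcongr; linarith
    have haK : a * K = Real.log (3 / 2) := div_mul_cancel₀ _ hK.ne'
    rw [← mul_assoc, haK] at this
    linarith
  have hpos : (0 : ℝ) < (1 / 2) ^ κ := by positivity
  simp only [layeredSHF_hash]
  refine lt_of_le_of_lt hprob ?_
  simp only [Polynomial.eval_add, Polynomial.eval_one]
  push_cast
  linarith

end Hash

theorem mainTheorem3
    -- the constant of the graph construction, and the graph parameter `s κ`
    (c : ℕ) (hc : 2 ≤ c) (s : ℕ → ℕ) (hs : ∀ κ, 2 ≤ s κ)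
    (hpoly : ∃ p : Polynomial ℕ, ∀ κ, s κ ≤ p.eval κ)
    -- the chosen subpyramids, and the input label
    (root : ∀ κ, ∀ i : Fin (s κ), Fin (s κ - i)) (ζ : ∀ κ, BitVec κ)
    -- the number of vertices of the graph
    (n : ℕ → ℕ) (hn : ∀ κ, n κ = Nat.card (layeredGraph (s κ) c (hs κ) hc (root κ)).V) :
    ∃ τ : ℕ → ℕ, (fun κ => (τ κ : ℝ)) =Θ[atTop] (fun κ => (n κ : ℝ)) ∧
      -- memory counted in bits
      (∀ (lam : ℕ) (Λ q : ℕ → ℕ),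
        (fun κ => (Λ κ : ℝ)) =Θ[atTop] (fun κ => √(n κ : ℝ)) →
        (fun κ => (Λ κ : ℝ) * Real.log (Λ κ)) =o[atTop] (fun κ => (q κ : ℝ)) →
        (layeredSHF c hc s hs root ζ).IsHard (fun _ => 1) (fun κ => Λ κ - lam) τ q) ∧
      -- memory counted in words of `κ` bits
      (∃ δ : ℝ, 0 < δ ∧ ∀ (lam : ℕ) (Λ q : ℕ → ℕ),
        (fun κ => (Λ κ : ℝ)) =Θ[atTop] (fun κ => √(n κ : ℝ)) →
        (∀ᶠ κ in atTop, (Λ κ : ℝ) ≤ δ * √(n κ : ℝ)) →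
        (fun κ => (Λ κ : ℝ) * Real.log (Λ κ)) =o[atTop] (fun κ => (q κ : ℝ)) →
        (layeredSHF c hc s hs root ζ).IsHard (fun κ => κ) (fun κ => Λ κ - lam) τ q) := by
  have hn_le : ∀ κ, (n κ : ℝ) ≤ (c + 9) * (s κ : ℝ) ^ 2 := fun κ => by
    rw [hn]
    exact_mod_cast card_layeredGraph_le
  have hle_n : ∀ κ, (s κ : ℝ) ^ 2 ≤ 4 * n κ := fun κ => by
    rw [hn]
    exact_mod_cast le_card_layeredGraph
  have hsqrt_le : ∀ κ, √(n κ : ℝ) ≤ (c + 9) * s κ := fun κ => by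
    refine Real.sqrt_le_iff.2 ⟨by positivity, (hn_le κ).trans ?_⟩
    rw [mul_pow]
    gcongr
    nlinarith [(Nat.cast_nonneg c : (0 : ℝ) ≤ c)]
  have hle_sqrt : ∀ κ, (s κ : ℝ) ≤ 2 * √(n κ : ℝ) := fun κ => by
    rw [← div_le_iff₀' (by norm_num)]
    refine Real.le_sqrt_of_sq_le ?_
    rw [div_pow]
    linarith [hle_n κ]
  -- the two consequences of the assumptions on `Λ` and `q` that both parts need
  have hlin : ∀ Λ : ℕ → ℕ, (fun κ => (Λ κ : ℝ)) =Θ[atTop] (fun κ => √(n κ : ℝ)) →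
      ∃ K : ℝ, 0 < K ∧ ∀ᶠ κ in atTop, (Λ κ : ℝ) ≤ K * s κ := by
    intro Λ hΛ
    obtain ⟨K, hK, hb⟩ := hΛ.1.exists_pos
    refine ⟨K * (c + 9), by positivity, ?_⟩
    filter_upwards [hb.bound] with κ h
    rw [Real.norm_of_nonneg (by positivity), Real.norm_of_nonneg (by positivity)] at h
    refine h.trans ?_
    rw [mul_assoc]
    gcongr
    exact hsqrt_le κ
  have hmany : ∀ (lam : ℕ) (Λ q : ℕ → ℕ),
      (fun κ => (Λ κ : ℝ)) =Θ[atTop] (fun κ => √(n κ : ℝ)) →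
      (fun κ => (Λ κ : ℝ) * Real.log (Λ κ)) =o[atTop] (fun κ => (q κ : ℝ)) →
      ∀ᶠ κ in atTop, 3 ≤ Λ κ - lam → 4 * s κ ≤ q κ := by
    intro lam Λ q hΛ hq
    obtain ⟨K, hK, hb⟩ := hΛ.2.exists_pos
    filter_upwards [hb.bound, hq.def (c := 1 / (8 * K)) (by positivity)] with κ h h' h3
    have hΛ3 : (3 : ℝ) ≤ Λ κ := by
      have : 3 ≤ Λ κ := by omega
      exact_mod_cast this
    have hlog : 1 ≤ Real.log (Λ κ) := by
      rw [Real.le_log_iff_exp_le (by linarith)]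
      linarith [Real.exp_one_lt_d9]
    rw [Real.norm_of_nonneg (by positivity), Real.norm_of_nonneg (by positivity)] at h h'
    have h1 : (4 * s κ : ℝ) ≤ 8 * K * (Λ κ * Real.log (Λ κ)) := by
      have h2 : (Λ κ : ℝ) ≤ Λ κ * Real.log (Λ κ) := le_mul_of_one_le_right (by linarith) hlog
      have h4 := mul_le_mul_of_nonneg_left h2 hK.le
      linarith [hle_sqrt κ]
    have h5 : 8 * K * (Λ κ * Real.log (Λ κ)) ≤ q κ := by
      rw [one_div_mul_eq_div, le_div_iff₀ (by positivity)] at h'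
      linarith
    exact_mod_cast h1.trans h5
  refine ⟨fun κ => BaseVertex.depth (s κ), ⟨?_, ?_⟩, ?_, 1 / (512 * (c + 9)), by positivity, ?_⟩
  · refine IsBigO.of_bound 4 (Eventually.of_forall fun κ => ?_)
    rw [Real.norm_of_nonneg (by positivity), Real.norm_of_nonneg (by positivity)]
    refine le_trans ?_ (hle_n κ)
    have : BaseVertex.depth (s κ) ≤ s κ ^ 2 := by
      have : 2 ^ 2 ≤ s κ ^ 2 := Nat.pow_le_pow_left (hs κ) 2
      simp only [BaseVertex.depth]
      omega
    exact_mod_cast this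
  · refine IsBigO.of_bound ((c + 9) * 100) (Eventually.of_forall fun κ => ?_)
    rw [Real.norm_of_nonneg (by positivity), Real.norm_of_nonneg (by positivity)]
    refine (hn_le κ).trans ?_
    rw [mul_assoc]
    gcongr
    have : s κ ^ 2 ≤ 100 * BaseVertex.depth (s κ) := by
      simp only [BaseVertex.depth]
      omega
    exact_mod_cast this
  · intro lam Λ q hΛ hq
    obtain ⟨K, hK, hΛK⟩ := hlin Λ hΛ
    have hΛK' : ∀ᶠ κ in atTop, ((Λ κ - lam : ℕ) : ℝ) ≤ K * s κ := by
      filter_upwards [hΛK] with κ h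
      exact (Nat.cast_le.2 (Nat.sub_le _ _)).trans h
    refine layeredSHF_isHard hpoly hK hΛK' ?_ (hmany lam Λ q hΛ hq)
    filter_upwards [hΛK', tendsto_natCast_atTop_atTop.eventually_ge_atTop (512 * K)] with κ h h'
    have : (512 * ((1 : ℕ) * (Λ κ - lam : ℕ)) : ℝ) ≤ κ * s κ := by
      calc (512 * ((1 : ℕ) * (Λ κ - lam : ℕ)) : ℝ) ≤ 512 * (K * s κ) := by
            rw [Nat.cast_one, one_mul]
            gcongr
        _ = 512 * K * s κ := by ring
        _ ≤ κ * s κ := by gcongr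
    exact_mod_cast this
  · intro lam Λ q hΛ hδ hq
    obtain ⟨K, hK, hΛK⟩ := hlin Λ hΛ
    refine layeredSHF_isHard hpoly hK ?_ ?_ (hmany lam Λ q hΛ hq)
    · filter_upwards [hΛK] with κ h
      exact (Nat.cast_le.2 (Nat.sub_le _ _)).trans h
    · filter_upwards [hδ] with κ h
      have h1 : (512 * Λ κ : ℝ) ≤ s κ := by
        have h2 := h.trans (mul_le_mul_of_nonneg_left (hsqrt_le κ) (by positivity))
        calc (512 * Λ κ : ℝ) ≤ 512 * (1 / (512 * (c + 9)) * ((c + 9) * s κ)) := by gcongr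
          _ = s κ := by field_simp
      have h3 : 512 * Λ κ ≤ s κ := by exact_mod_cast h1
      calc 512 * (κ * (Λ κ - lam)) = κ * (512 * (Λ κ - lam)) := by ring
        _ ≤ κ * s κ := Nat.mul_le_mul_left _ (by omega)
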